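/- Let $\mathbb{H}=\{\xi\in\mathbb{C}:\operatorname{Re}\xi>0\}$ and let $\operatorname{Arg}$ denote the principal argument. A function $f$ holomorphic in $\mathbb{H}$ is called a Rogers function if $\operatorname{Re}(f(\xi)/\xi)\ge 0$ for all $\xi\in\mathbb{H}$; its spine is $\Gamma_f=\{\xi\in\mathbb{H}: f(\xi)\in(0,\infty)\}$. Let $f$ be a non-constant Rogers function. There is a unique continuous function $\zeta_f:(0,\infty)\to\mathbb{C}$ with the following two properties: (a) $|\zeta_f(r)|=r$ and $\operatorname{Arg}\zeta_f(r)\in[-\tfrac{\pi}{2},\tfrac{\pi}{2}]$ for all $r>0$; (b) $\operatorname{sign}\operatorname{Im}f(\xi)=\operatorname{sign}\bigl(\operatorname{Arg}\xi-\operatorname{Arg}\zeta_f(|\xi|)\bigr)$ for all $\xi\in\mathbb{H}$. Moreover, with $Z_f=\{r\in(0,\infty):\operatorname{Arg}\zeta_f(r)\in(-\tfrac{\pi}{2},\tfrac{\pi}{2})\}$ and $\vartheta(r)=\operatorname{Arg}\zeta_f(r)$: (c) The spine $\Gamma_f$ is a union of pairwise disjoint simple (regular) real-analytic curves, each of which begins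 and ends at the imaginary axis or at complex infinity. Furthermore, $\Gamma_f=\{\zeta_f(r):r\in Z_f\}$, and $\zeta_f$ is real-analytic on $Z_f$. (d) For every $r>0$, the part of the spine in the annulus $r\le|\xi|\le 2r$, namely $\{\zeta_f(s):s\in Z_f\cap[r,2r]\}$, is a system of rectifiable curves (the restrictions of $\zeta_f$ to the connected components of $Z_f\cap[r,2r]$) of total length at most $300\,r$. Furthermore, $\vartheta$ is twice continuously differentiable on $Z_f$, and for every $r\in Z_f$, $$\bigl|r\,(r\,\vartheta'(r))'\bigr|\le\frac{9\,\bigl((r\,\vartheta'(r))^2+1\bigr)}{\cos\vartheta(r)}.$$ -/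

import Mathlib

open Set Filter Topology
open scoped ENNReal Real

/-- The open right half-plane `ℍ = {ξ : re ξ > 0}`. -/
def rightHalfPlane : Set ℂ := {ξ | 0 < ξ.re}

/-- Rogers functions: holomorphic in the right half-plane, with `re (f ξ / ξ) ≥ 0` there.
The values of `f` outside the half-plane are irrelevant. -/
structure IsRogers (f : ℂ → ℂ) : Prop where
  holo : DifferentiableOn ℂ f rightHalfPlane
  re_nonneg : ∀ ξ ∈ rightHalfPlane, 0 ≤ (f ξ / ξ).re

/-- `f` is constant on the right half-plane. -/
def IsConstOnHalfPlane (f : ℂ → ℂ) : Prop :=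
  ∃ c : ℂ, ∀ ξ ∈ rightHalfPlane, f ξ = c

/-- The spine `Γ_f`: the points of the right half-plane where `f` takes values in `(0, ∞)`. -/
def spine (f : ℂ → ℂ) : Set ℂ :=
  {ξ | ξ ∈ rightHalfPlane ∧ ∃ x : ℝ, 0 < x ∧ f ξ = (x : ℂ)}

/-- `ζ` is (on `(0, ∞)`) continuous, with `|ζ r| = r` and `Arg (ζ r) ∈ [-π/2, π/2]`, and on each
circle the sign of `im f` is the sign of `Arg ξ - Arg (ζ |ξ|)`. Values of `ζ` at `r ≤ 0` are
irrelevant. -/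
structure IsSpineFunction (f : ℂ → ℂ) (ζ : ℝ → ℂ) : Prop where
  cont : ContinuousOn ζ (Ioi 0)
  norm_eq : ∀ r : ℝ, 0 < r → ‖ζ r‖ = r
  arg_mem : ∀ r : ℝ, 0 < r → (ζ r).arg ∈ Icc (-(π / 2)) (π / 2)
  sign_im : ∀ ξ ∈ rightHalfPlane,
    SignType.sign (f ξ).im = SignType.sign (ξ.arg - (ζ ‖ξ‖).arg)

/-- The set `Z = {r ∈ (0, ∞) : Arg (ζ r) ∈ (-π/2, π/2)}`. -/
def spineRadii (ζ : ℝ → ℂ) : Set ℝ :=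
  {r | 0 < r ∧ (ζ r).arg ∈ Ioo (-(π / 2)) (π / 2)}

/-- Along the filter `l`, the curve `γ` converges to a point of the imaginary axis, or to
complex infinity. -/
def EndsAtAxisOrInfinity (γ : ℝ → ℂ) (l : Filter ℝ) : Prop :=
  (∃ p : ℂ, p.re = 0 ∧ Tendsto γ l (𝓝 p)) ∨ Tendsto γ l (cocompact ℂ)

/-- `C` is a simple (injectively parametrised), regular real-analytic open curve, which begins and
ends at the imaginary axis or at complex infinity. -/
def IsSimpleAnalyticCurve (C : Set ℂ) : Prop :=
  ∃ γ : ℝ → ℂ, AnalyticOnNhd ℝ γ (Ioo 0 1) ∧ (∀ t ∈ Ioo (0 : ℝ) 1, deriv γ t ≠ 0) ∧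
    InjOn γ (Ioo 0 1) ∧ γ '' Ioo 0 1 = C ∧
    EndsAtAxisOrInfinity γ (𝓝[>] 0) ∧ EndsAtAxisOrInfinity γ (𝓝[<] 1)

/-- Total length of the system of curves `γ|_J`, where `J` runs over the connected components
(intervals) of the parameter set `S ⊆ ℝ`; the length of a single curve is its total variation. -/
noncomputable def totalLength (γ : ℝ → ℂ) (S : Set ℝ) : ℝ≥0∞ :=
  ∑' J : {J : Set ℝ | ∃ x ∈ S, J = connectedComponentIn S x}, eVariationOn γ (J : Set ℝ)

/-!
Write `F w = f (exp w)` on the strip `|im w| < π / 2`, so that circles about the origin become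
vertical segments, and put `B = cos α * re F' + sin α * im F` at `w = R + i α` (`angularSlope`).
Then `B / cos² α` is the derivative in `α` of `im F / cos α`.

Everything follows from two inequalities of Schwarz–Pick type. Transplanted to the unit disc with
`w` going to the centre, `f ξ / ξ` is a function `H` with nonnegative real part, that is, up to an
imaginary constant the Herglotz integral of a measure `μ` on the circle. In these terms `B` is a
multiple of `∫ (1 + cos θ) dμ ≥ 0`, while certain combinations of `F`, `F'` and `F''` are the
components of the same multiple of `2 ∫ (1 + cos θ) e^{iθ} dμ` up to a rotation; therefore they are
bounded by `2 B` (`IsRogers.exists_gradient_angularSlope`). No measure is needed: one applies the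
first-order inequality at the centre to the function whose boundary real part is
`(1 + cos θ) re H` (`circleMultiplier`).

If `B` vanishes at one point, `μ` is a point mass and `f ξ = κ + i k ξ`; then `im f` has a constant
sign and the angle of the spine is constantly `π / 2` or `-π / 2`. Otherwise `B > 0` throughout,
`im F / cos α` is strictly increasing in `α`, and its change of sign defines the angle `ϑ R`. This
gives existence, uniqueness and continuity of the spine function. Where `|ϑ| < π / 2` one has
`re F' = B / cos ϑ > 0`, and the inverse function theorem makes `ϑ` analytic. Differentiating
`im F (R + i ϑ R) = 0` twice and inserting the second-order bound yields
`|cos ϑ * ϑ'' + sin ϑ * (1 + ϑ'²)| ≤ 2 (1 + ϑ'²)` (`IsSpineAngle.curvature_le`), which contains the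
bound for the curvature.

The length of the spine in an annulus is controlled by the total variation of `ϑ` over an interval
of length `log 2`, which is a sum over the maximal monotone arcs of `ϑ`. The differential inequality
bounds the second derivative of `-1 / (1 + sin ϑ)`, so that an arc which starts horizontally and
not too close to the lower side of the strip has mean slope at most `10`
(`IsCurvatureBoundedAngle.sub_le_or_crosses`). By symmetry, besides the two arcs at the ends of the
interval only those arcs are exceptional that cross the middle of the strip, from one side of
`|α| ≤ π / 6` to the other. On `α = 0` the function `p = im F` vanishes at the crossings and
satisfies `|p'' - p| ≤ 2 B`; it is thus too small between two crossings at distance at most `1 / 10`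
for `|ϑ|` to reach `π / 6` there (`IsSpineAngle.abs_lt_of_zeros`). So there are at most ten
exceptional crossings, each with a variation of at most `π`.
-/

open MeasureTheory
open scoped ContDiff

/-! ### Holomorphic functions with nonnegative real part on the unit disc -/

theorem Complex.norm_sub_lt_norm_add_conj {a b : ℂ} (ha : 0 < a.re) (hb : 0 < b.re) :
    ‖a - b‖ < ‖a + (starRingEnd ℂ) b‖ := by
  rw [← sq_lt_sq₀ (norm_nonneg _) (norm_nonneg _), Complex.sq_norm, Complex.sq_norm,
    Complex.normSq_apply, Complex.normSq_apply]
  simp only [Complex.sub_re, Complex.sub_im, Complex.add_re, Complex.add_im, Complex.conj_re,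
    Complex.conj_im]
  nlinarith [mul_pos ha hb]

theorem norm_deriv_zero_le_of_re_pos {G : ℂ → ℂ} (hG : DifferentiableOn ℂ G (Metric.ball 0 1))
    (hre : ∀ z ∈ Metric.ball (0 : ℂ) 1, 0 < (G z).re) :
    ‖deriv G 0‖ ≤ 2 * (G 0).re := by
  have h0 : (0 : ℂ) ∈ Metric.ball (0 : ℂ) 1 := by simp
  have hne : ∀ z ∈ Metric.ball (0 : ℂ) 1, G z + (starRingEnd ℂ) (G 0) ≠ 0 := fun z hz h => by
    have := congrArg Complex.re h
    simp only [Complex.add_re, Complex.conj_re, Complex.zero_re] at this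
    linarith [hre z hz, hre 0 h0]
  have hd : HasDerivAt (fun z => (G z - G 0) / (G z + (starRingEnd ℂ) (G 0)))
      ((deriv G 0 * (G 0 + (starRingEnd ℂ) (G 0)) - (G 0 - G 0) * deriv G 0) /
        (G 0 + (starRingEnd ℂ) (G 0)) ^ 2) 0 := by
    have h := (hG.differentiableAt (Metric.isOpen_ball.mem_nhds h0)).hasDerivAt
    exact (h.sub_const _).div (h.add_const _) (hne 0 h0)
  have hle := Complex.norm_deriv_le_one_of_mapsTo_ball (c := (0 : ℂ)) (R := 1)
    (f := fun z => (G z - G 0) / (G z + (starRingEnd ℂ) (G 0)))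
    ((hG.sub_const _).div (hG.add_const _) hne) (fun z hz => by
      simp only [sub_self, zero_div, Metric.mem_closedBall, dist_zero_right,
        norm_div]
      exact ((div_lt_one (norm_pos_iff.2 (hne z hz))).2
        (Complex.norm_sub_lt_norm_add_conj (hre z hz) (hre 0 h0))).le) one_pos
  rw [hd.deriv] at hle
  have hp := hre 0 h0
  have e : G 0 + (starRingEnd ℂ) (G 0) = ((2 * (G 0).re : ℝ) : ℂ) := Complex.add_conj _
  rw [e, sub_self, zero_mul, sub_zero, norm_div, norm_mul, norm_pow, Complex.norm_real,
    Real.norm_of_nonneg (by positivity), div_le_one (by positivity), sq] at hle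
  exact le_of_mul_le_mul_right hle (by positivity)

/-- The Schwarz–Pick inequality at the centre of the disc. -/
theorem norm_deriv_zero_le_of_re_nonneg {G : ℂ → ℂ} (hG : DifferentiableOn ℂ G (Metric.ball 0 1))
    (hre : ∀ z ∈ Metric.ball (0 : ℂ) 1, 0 ≤ (G z).re) :
    ‖deriv G 0‖ ≤ 2 * (G 0).re := by
  refine le_of_forall_pos_le_add fun ε hε => ?_
  have h := norm_deriv_zero_le_of_re_pos (G := fun z => G z + ((ε / 2 : ℝ) : ℂ))
    (hG.add_const _) (fun z hz => by
      rw [Complex.add_re, Complex.ofReal_re]; linarith [hre z hz])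
  rw [deriv_add_const, Complex.add_re, Complex.ofReal_re] at h
  linarith

/-- A multiple of `H z * (1 + (z + z⁻¹) / 2)` with the pole at `0` removed without changing the
real part on the unit circle; there `1 + (z + z⁻¹) / 2 = 1 + re z ≥ 0`. -/
noncomputable def circleMultiplier (H : ℂ → ℂ) (z : ℂ) : ℂ :=
  H z + z * H z / 2 + dslope H 0 z / 2 + (starRingEnd ℂ) (H 0) * z / 2

theorem differentiableOn_circleMultiplier {H : ℂ → ℂ}
    (hH : DifferentiableOn ℂ H (Metric.ball 0 1)) :
    DifferentiableOn ℂ (circleMultiplier H) (Metric.ball 0 1) := by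
  have hd : DifferentiableOn ℂ (dslope H 0) (Metric.ball 0 1) :=
    (Complex.differentiableOn_dslope (Metric.ball_mem_nhds _ one_pos)).2 hH
  unfold circleMultiplier
  exact ((hH.add ((differentiableOn_id.mul hH).div_const _)).add (hd.div_const _)).add
    (((differentiableOn_const _).mul differentiableOn_id).div_const _)

theorem re_circleMultiplier_nonneg {H : ℂ → ℂ}
    (hH : DifferentiableOn ℂ H (Metric.ball 0 1))
    (hre : ∀ z ∈ Metric.ball (0 : ℂ) 1, 0 ≤ (H z).re) {z : ℂ} (hz : z ∈ Metric.ball (0 : ℂ) 1) :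
    0 ≤ (circleMultiplier H z).re := by
  have hd : DifferentiableOn ℂ (dslope H 0) (Metric.ball 0 1) :=
    (Complex.differentiableOn_dslope (Metric.ball_mem_nhds _ one_pos)).2 hH
  -- the same construction for the dilation `w ↦ H (ρ w)`, which is holomorphic past the circle
  let G : ℝ → ℂ → ℂ := fun ρ w => H (ρ * w) + w * H (ρ * w) / 2 + ρ * dslope H 0 (ρ * w) / 2 +
    (starRingEnd ℂ) (H 0) * w / 2
  have hmem : ∀ ρ : ℝ, ρ ∈ Ioo (0 : ℝ) 1 → ∀ w : ℂ, ‖w‖ ≤ 1 →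
      (ρ * w : ℂ) ∈ Metric.ball (0 : ℂ) 1 := fun ρ hρ w hw => by
    rw [mem_ball_zero_iff, norm_mul, Complex.norm_real, Real.norm_of_nonneg hρ.1.le]
    nlinarith [hρ.1, hρ.2, norm_nonneg w]
  have hG : ∀ ρ : ℝ, ρ ∈ Ioo (0 : ℝ) 1 → 0 ≤ (G ρ z).re := by
    intro ρ hρ
    have hdiff : DifferentiableOn ℂ (G ρ) (Metric.closedBall 0 1) := by
      intro w hw
      have hw' := hmem ρ hρ w (by simpa using hw)
      have hmul : DifferentiableAt ℂ (fun w : ℂ => (ρ : ℂ) * w) w :=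
        differentiableAt_id.const_mul _
      have h1 : DifferentiableAt ℂ (fun w : ℂ => H (ρ * w)) w :=
        (hH.differentiableAt (Metric.isOpen_ball.mem_nhds hw')).comp w hmul
      have h2 : DifferentiableAt ℂ (fun w : ℂ => dslope H 0 (ρ * w)) w :=
        (hd.differentiableAt (Metric.isOpen_ball.mem_nhds hw')).comp w hmul
      exact (((h1.add ((differentiableAt_id.mul h1).div_const _)).add
        ((h2.const_mul _).div_const _)).add
        ((differentiableAt_id.const_mul _).div_const _)).differentiableWithinAt
    have hle : ‖Complex.exp (-G ρ z)‖ ≤ 1 := by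
      refine Complex.norm_le_of_forall_mem_frontier_norm_le (f := fun w => Complex.exp (-G ρ w))
        Metric.isBounded_ball (U := Metric.ball (0 : ℂ) 1)
        (DifferentiableOn.diffContOnCl ?_) ?_ (subset_closure hz)
      · rw [closure_ball _ one_ne_zero]; exact hdiff.neg.cexp
      · intro w hw
        rw [frontier_ball _ one_ne_zero, mem_sphere_zero_iff_norm] at hw
        rw [Complex.norm_exp, Real.exp_le_one_iff, Complex.neg_re, neg_nonpos]
        have hw0 : w ≠ 0 := by rintro rfl; simp at hw
        have hρ0 : (ρ : ℂ) ≠ 0 := by exact_mod_cast hρ.1.ne'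
        have hsl : ρ * dslope H 0 (ρ * w) = (starRingEnd ℂ) w * (H (ρ * w) - H 0) := by
          rw [dslope_of_ne _ (mul_ne_zero hρ0 hw0), slope_def_field, sub_zero]
          have : (starRingEnd ℂ) w = w⁻¹ := by
            rw [Complex.inv_def, Complex.normSq_eq_norm_sq, hw]; simp
          rw [this]; field_simp
        have hval : (G ρ w).re = (H (ρ * w)).re * (1 + w.re) := by
          simp only [G, hsl]
          simp only [Complex.add_re, Complex.mul_re, Complex.sub_re, Complex.sub_im,
            Complex.conj_re, Complex.conj_im, Complex.div_ofNat_re]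
          ring
        rw [hval]
        have := Complex.abs_re_le_norm w
        rw [hw, abs_le] at this
        exact mul_nonneg (hre _ (hmem ρ hρ w hw.le)) (by linarith [this.1])
    rw [Complex.norm_exp, Real.exp_le_one_iff, Complex.neg_re, neg_nonpos] at hle
    exact hle
  have hc : ContinuousAt (fun ρ : ℝ => (G ρ z).re) 1 := by
    have hmul : ContinuousAt (fun ρ : ℝ => (ρ : ℂ) * z) 1 :=
      (Complex.continuous_ofReal.mul continuous_const).continuousAt
    have hz1 : (((1 : ℝ) : ℂ) * z) ∈ Metric.ball (0 : ℂ) 1 := by simpa using hz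
    have h1 : ContinuousAt (fun ρ : ℝ => H (ρ * z)) 1 :=
      ContinuousAt.comp (f := fun ρ : ℝ => (ρ : ℂ) * z)
        (hH.differentiableAt (Metric.isOpen_ball.mem_nhds hz1)).continuousAt hmul
    have h2 : ContinuousAt (fun ρ : ℝ => dslope H 0 (ρ * z)) 1 :=
      ContinuousAt.comp (f := fun ρ : ℝ => (ρ : ℂ) * z)
        (hd.differentiableAt (Metric.isOpen_ball.mem_nhds hz1)).continuousAt hmul
    exact Complex.continuous_re.continuousAt.comp
      (((h1.add ((continuousAt_const.mul h1).div_const _)).add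
      ((Complex.continuous_ofReal.continuousAt.mul h2).div_const _)).add continuousAt_const)
  have hlim : Tendsto (fun ρ : ℝ => (G ρ z).re) (𝓝[<] 1) (𝓝 (G 1 z).re) :=
    hc.tendsto.mono_left nhdsWithin_le_nhds
  have h1 : G 1 z = circleMultiplier H z := by simp [G, circleMultiplier]
  rw [← h1]
  exact ge_of_tendsto hlim (by
    filter_upwards [Ioo_mem_nhdsLT (zero_lt_one (α := ℝ))] with ρ hρ using hG ρ hρ)

theorem circleMultiplier_zero (H : ℂ → ℂ) :
    circleMultiplier H 0 = H 0 + deriv H 0 / 2 := by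
  simp [circleMultiplier]

theorem deriv_dslope_zero {H : ℂ → ℂ} (hH : DifferentiableOn ℂ H (Metric.ball 0 1)) :
    deriv (dslope H 0) 0 = deriv (deriv H) 0 / 2 := by
  have hb := Metric.ball_mem_nhds (0 : ℂ) one_pos
  have hd : DifferentiableOn ℂ (dslope H 0) (Metric.ball 0 1) :=
    (Complex.differentiableOn_dslope hb).2 hH
  have hmul : ∀ z, H z = H 0 + z * dslope H 0 z := fun z => by
    have := sub_smul_dslope H 0 z
    rw [sub_zero, smul_eq_mul] at this
    rw [this]; ring
  have h1 : deriv H =ᶠ[𝓝 0] fun z => dslope H 0 z + z * deriv (dslope H 0) z := by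
    filter_upwards [hb] with z hz
    have h := (hd.differentiableAt (Metric.isOpen_ball.mem_nhds hz)).hasDerivAt
    have h2 : HasDerivAt H (1 * dslope H 0 z + z * deriv (dslope H 0) z) z :=
      (((hasDerivAt_id z).mul h).const_add (H 0)).congr_of_eventuallyEq
        (Eventually.of_forall hmul)
    rw [h2.deriv, one_mul]
  rw [h1.deriv_eq]
  have hda := (hd.differentiableAt hb).hasDerivAt
  have hdd := ((hd.deriv Metric.isOpen_ball).differentiableAt hb).hasDerivAt
  have h3 := (hda.add ((hasDerivAt_id (0 : ℂ)).mul hdd)).deriv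
  simp only [id, one_mul, zero_mul, add_zero] at h3
  have h4 : deriv (fun z => dslope H 0 z + z * deriv (dslope H 0) z) 0 =
    deriv (dslope H 0) 0 + deriv (dslope H 0) 0 := h3
  rw [h4]; ring

theorem deriv_circleMultiplier_zero {H : ℂ → ℂ}
    (hH : DifferentiableOn ℂ H (Metric.ball 0 1)) :
    deriv (circleMultiplier H) 0 = (H 0).re + deriv H 0 + deriv (deriv H) 0 / 4 := by
  have hb := Metric.ball_mem_nhds (0 : ℂ) one_pos
  have hd : DifferentiableOn ℂ (dslope H 0) (Metric.ball 0 1) :=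
    (Complex.differentiableOn_dslope hb).2 hH
  have h1 := (hH.differentiableAt hb).hasDerivAt
  have h2 := (hd.differentiableAt hb).hasDerivAt
  rw [deriv_dslope_zero hH] at h2
  have h : HasDerivAt (circleMultiplier H) _ 0 := ((h1.add (((hasDerivAt_id (0 : ℂ)).mul
    h1).div_const 2)).add (h2.div_const 2)).add
    (((hasDerivAt_id (0 : ℂ)).const_mul ((starRingEnd ℂ) (H 0))).div_const 2)
  rw [h.deriv]
  have e : (starRingEnd ℂ) (H 0) = 2 * (H 0).re - H 0 := by
    have := Complex.add_conj (H 0)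
    push_cast at this
    linear_combination this
  simp only [id, one_mul, zero_mul, add_zero, mul_one, e]
  ring

/-- A second-order form of the Schwarz–Pick inequality. In terms of the measure `μ` on the circle
that represents `H`, it says that `∫ (1 + cos θ) e^{iθ} dμ` is at most `∫ (1 + cos θ) dμ` in
absolute value. -/
theorem norm_second_order_le {H : ℂ → ℂ} (hH : DifferentiableOn ℂ H (Metric.ball 0 1))
    (hre : ∀ z ∈ Metric.ball (0 : ℂ) 1, 0 ≤ (H z).re) :
    ‖((H 0).re : ℂ) + deriv H 0 + deriv (deriv H) 0 / 4‖ ≤ 2 * ((H 0).re + (deriv H 0).re / 2) := by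
  have h := norm_deriv_zero_le_of_re_nonneg (differentiableOn_circleMultiplier hH)
    (fun z hz => re_circleMultiplier_nonneg hH hre hz)
  rw [deriv_circleMultiplier_zero hH, circleMultiplier_zero, Complex.add_re,
    Complex.div_ofNat_re] at h
  exact h

theorem eqOn_const_of_re_nonneg {G : ℂ → ℂ} (hG : DifferentiableOn ℂ G (Metric.ball 0 1))
    (hre : ∀ z ∈ Metric.ball (0 : ℂ) 1, 0 ≤ (G z).re) (h0 : (G 0).re = 0) :
    ∀ z ∈ Metric.ball (0 : ℂ) 1, G z = G 0 := by
  have hb : (0 : ℂ) ∈ Metric.ball (0 : ℂ) 1 := by simp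
  have hexp := Complex.eqOn_of_isPreconnected_of_isMaxOn_norm
    (f := fun z => Complex.exp (-G z)) (convex_ball (0 : ℂ) 1).isPreconnected
    Metric.isOpen_ball hG.neg.cexp hb (fun z hz => by
      simp only [Function.comp, mem_ofPred_eq, Complex.norm_exp, Complex.neg_re, h0]
      exact Real.exp_le_exp.2 (by linarith [hre z hz]))
  have hder : ∀ z ∈ Metric.ball (0 : ℂ) 1, deriv G z = 0 := fun z hz => by
    have hn := Metric.isOpen_ball.mem_nhds hz
    have h1 := ((hG.differentiableAt hn).hasDerivAt.neg.cexp).deriv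
    have h2 : (fun z => Complex.exp (-G z)) =ᶠ[𝓝 z] fun _ => Complex.exp (-G 0) := by
      filter_upwards [hn] with w hw using hexp hw
    have h3 := h2.deriv_eq
    rw [deriv_const] at h3
    have h4 := h1.symm.trans h3
    simpa [Complex.exp_ne_zero] using h4
  intro z hz
  exact (convex_ball (0 : ℂ) 1).is_const_of_fderivWithin_eq_zero (𝕜 := ℂ) hG (fun w hw => by
    rw [fderivWithin_of_isOpen Metric.isOpen_ball hw]
    ext
    simp [hder w hw]) hz hb

/-- The functions for which the quantity `re (circleMultiplier H 0)` vanishes: in terms of the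
representing measure, these are the functions whose measure is carried by the point `-1`. -/
theorem eq_div_of_re_circleMultiplier_eq_zero {H : ℂ → ℂ}
    (hH : DifferentiableOn ℂ H (Metric.ball 0 1))
    (hre : ∀ z ∈ Metric.ball (0 : ℂ) 1, 0 ≤ (H z).re)
    (h0 : (H 0).re + (deriv H 0).re / 2 = 0) {z : ℂ} (hz : z ∈ Metric.ball (0 : ℂ) 1) :
    H z * (1 + z) = H 0 - (starRingEnd ℂ) (H 0) * z := by
  have hc := eqOn_const_of_re_nonneg (differentiableOn_circleMultiplier hH)
    (fun z hz => re_circleMultiplier_nonneg hH hre hz)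
    (by rw [circleMultiplier_zero, Complex.add_re, Complex.div_ofNat_re, h0]) z hz
  have h1 : (deriv H 0).im = 0 := by
    have h := norm_deriv_zero_le_of_re_nonneg hH hre
    have h2 := Complex.sq_norm (deriv H 0)
    rw [Complex.normSq_apply] at h2
    have h3 : ‖deriv H 0‖ ^ 2 ≤ (2 * (H 0).re) ^ 2 := pow_le_pow_left₀ (norm_nonneg _) h 2
    have h4 : (deriv H 0).re = -(2 * (H 0).re) := by linarith
    rw [h4] at h2
    nlinarith
  rw [circleMultiplier_zero] at hc
  have hs : H z = H 0 + z * dslope H 0 z := by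
    have := sub_smul_dslope H 0 z
    rw [sub_zero, smul_eq_mul] at this
    rw [this]; ring
  have hd : deriv H 0 = -(H 0 + (starRingEnd ℂ) (H 0)) := by
    rw [Complex.add_conj]
    apply Complex.ext
    · simp only [Complex.neg_re, Complex.ofReal_re]; linarith
    · simp only [Complex.neg_im, Complex.ofReal_im, h1, neg_zero]
  have hz1 : (1 + z) ≠ 0 := fun h => by
    have : z = -1 := by linear_combination h
    rw [this] at hz; simp at hz
  unfold circleMultiplier at hc
  rw [hd] at hc
  apply mul_right_cancel₀ hz1
  linear_combination 2 * z * hc + hs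

/-! ### The half-plane and the strip -/

theorem isOpen_rightHalfPlane : IsOpen rightHalfPlane :=
  isOpen_lt continuous_const Complex.continuous_re

theorem ne_zero_of_mem_rightHalfPlane {ξ : ℂ} (h : ξ ∈ rightHalfPlane) : ξ ≠ 0 := by
  rintro rfl; exact lt_irrefl (0 : ℝ) h

theorem add_conj_ne_zero_of_mem_rightHalfPlane {ξ ξ₀ : ℂ} (h : ξ ∈ rightHalfPlane)
    (h₀ : ξ₀ ∈ rightHalfPlane) : (starRingEnd ℂ) ξ₀ + ξ ≠ 0 := fun e => by
  have := congrArg Complex.re e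
  simp only [Complex.add_re, Complex.conj_re, Complex.zero_re] at this
  have h1 : 0 < ξ.re := h
  have h2 : 0 < ξ₀.re := h₀
  linarith

/-- The Möbius map of the unit disc onto the right half-plane that takes `0` to `ξ₀` and `-1` to
`0`. -/
noncomputable def discToHalfPlane (ξ₀ z : ℂ) : ℂ :=
  ξ₀ * (starRingEnd ℂ) ξ₀ * (1 + z) / ((starRingEnd ℂ) ξ₀ - ξ₀ * z)

section DiscToHalfPlane

variable {ξ₀ : ℂ}

theorem discToHalfPlane_denom_ne_zero (h₀ : ξ₀ ∈ rightHalfPlane) {z : ℂ}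
    (hz : z ∈ Metric.ball (0 : ℂ) 1) : (starRingEnd ℂ) ξ₀ - ξ₀ * z ≠ 0 := fun h => by
  have h1 : ‖(starRingEnd ℂ) ξ₀‖ = ‖ξ₀ * z‖ := congrArg _ (sub_eq_zero.1 h)
  rw [RCLike.norm_conj, norm_mul] at h1
  have h2 : 0 < ‖ξ₀‖ := norm_pos_iff.2 (ne_zero_of_mem_rightHalfPlane h₀)
  rw [mem_ball_zero_iff] at hz
  nlinarith

theorem discToHalfPlane_mem (h₀ : ξ₀ ∈ rightHalfPlane) {z : ℂ}
    (hz : z ∈ Metric.ball (0 : ℂ) 1) : discToHalfPlane ξ₀ z ∈ rightHalfPlane := by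
  have hne := discToHalfPlane_denom_ne_zero h₀ hz
  have hN : 0 < Complex.normSq ξ₀ := Complex.normSq_pos.2 (ne_zero_of_mem_rightHalfPlane h₀)
  have hx : 0 < ξ₀.re := h₀
  rw [mem_ball_zero_iff, ← sq_lt_one_iff₀ (norm_nonneg _), Complex.sq_norm,
    Complex.normSq_apply] at hz
  have hnum : (ξ₀ * (starRingEnd ℂ) ξ₀ * (1 + z) *
      (starRingEnd ℂ) ((starRingEnd ℂ) ξ₀ - ξ₀ * z)).re =
      Complex.normSq ξ₀ * (ξ₀.re * (1 - (z.re * z.re + z.im * z.im))) := by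
    rw [Complex.mul_conj]
    simp only [Complex.mul_re, Complex.mul_im, Complex.add_re, Complex.add_im, Complex.one_re,
      Complex.one_im, Complex.ofReal_re, Complex.ofReal_im, map_sub, map_mul, Complex.conj_conj,
      Complex.sub_re, Complex.sub_im, Complex.conj_re, Complex.conj_im]
    ring
  change 0 < (discToHalfPlane ξ₀ z).re
  have e : discToHalfPlane ξ₀ z = (ξ₀ * (starRingEnd ℂ) ξ₀ * (1 + z) *
      (starRingEnd ℂ) ((starRingEnd ℂ) ξ₀ - ξ₀ * z)) *
      ((Complex.normSq ((starRingEnd ℂ) ξ₀ - ξ₀ * z))⁻¹ : ℝ) := by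
    rw [discToHalfPlane, div_eq_mul_inv, Complex.inv_def]; push_cast; ring
  rw [e, Complex.re_mul_ofReal, hnum]
  have := Complex.normSq_pos.2 hne
  have h1 : 0 < 1 - (z.re * z.re + z.im * z.im) := by linarith
  positivity

theorem discToHalfPlane_zero (h₀ : ξ₀ ∈ rightHalfPlane) : discToHalfPlane ξ₀ 0 = ξ₀ := by
  have : (starRingEnd ℂ) ξ₀ ≠ 0 := by
    simpa using ne_zero_of_mem_rightHalfPlane h₀
  simp only [discToHalfPlane, add_zero, mul_one, mul_zero, sub_zero]
  field_simp

theorem hasDerivAt_discToHalfPlane (h₀ : ξ₀ ∈ rightHalfPlane) {z : ℂ}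
    (hz : z ∈ Metric.ball (0 : ℂ) 1) :
    HasDerivAt (discToHalfPlane ξ₀) (ξ₀ * (starRingEnd ℂ) ξ₀ * ((starRingEnd ℂ) ξ₀ + ξ₀) /
      ((starRingEnd ℂ) ξ₀ - ξ₀ * z) ^ 2) z := by
  have hne := discToHalfPlane_denom_ne_zero h₀ hz
  have h1 : HasDerivAt (fun z : ℂ => ξ₀ * (starRingEnd ℂ) ξ₀ * (1 + z))
      (ξ₀ * (starRingEnd ℂ) ξ₀ * 1) z := ((hasDerivAt_id z).const_add 1).const_mul _
  have h2 : HasDerivAt (fun z : ℂ => (starRingEnd ℂ) ξ₀ - ξ₀ * z) (-(ξ₀ * 1)) z :=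
    ((hasDerivAt_id z).const_mul ξ₀).const_sub _
  refine (h1.div h2 hne).congr_deriv ?_
  congr 1
  ring

theorem hasDerivAt_deriv_discToHalfPlane (h₀ : ξ₀ ∈ rightHalfPlane) :
    HasDerivAt (fun z => ξ₀ * (starRingEnd ℂ) ξ₀ * ((starRingEnd ℂ) ξ₀ + ξ₀) /
      ((starRingEnd ℂ) ξ₀ - ξ₀ * z) ^ 2)
      (2 * ξ₀ ^ 2 * ((starRingEnd ℂ) ξ₀ + ξ₀) / (starRingEnd ℂ) ξ₀ ^ 2) 0 := by
  have hc : (starRingEnd ℂ) ξ₀ ≠ 0 := by simpa using ne_zero_of_mem_rightHalfPlane h₀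
  have h2 : HasDerivAt (fun z : ℂ => (starRingEnd ℂ) ξ₀ - ξ₀ * z) (-(ξ₀ * 1)) 0 :=
    ((hasDerivAt_id (0 : ℂ)).const_mul ξ₀).const_sub _
  have h3 := (hasDerivAt_const (0 : ℂ)
    (ξ₀ * (starRingEnd ℂ) ξ₀ * ((starRingEnd ℂ) ξ₀ + ξ₀))).div (h2.pow 2)
    (by simpa using ne_zero_of_mem_rightHalfPlane h₀)
  refine h3.congr_deriv ?_
  simp only [Pi.pow_apply, mul_zero, sub_zero]
  field_simp
  ring

/-- The inverse of `discToHalfPlane ξ₀`. -/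
noncomputable def halfPlaneToDisc (ξ₀ ξ : ℂ) : ℂ :=
  (starRingEnd ℂ) ξ₀ * (ξ - ξ₀) / (ξ₀ * ((starRingEnd ℂ) ξ₀ + ξ))

theorem halfPlaneToDisc_mem (h₀ : ξ₀ ∈ rightHalfPlane) {ξ : ℂ} (h : ξ ∈ rightHalfPlane) :
    halfPlaneToDisc ξ₀ ξ ∈ Metric.ball (0 : ℂ) 1 := by
  have h1 := Complex.norm_sub_lt_norm_add_conj (a := ξ) (b := ξ₀) h h₀
  have h2 : 0 < ‖ξ₀‖ := norm_pos_iff.2 (ne_zero_of_mem_rightHalfPlane h₀)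
  rw [mem_ball_zero_iff, halfPlaneToDisc, norm_div, norm_mul, norm_mul, RCLike.norm_conj,
    mul_div_mul_left _ _ h2.ne', add_comm, div_lt_one ((norm_nonneg _).trans_lt h1)]
  exact h1

theorem one_add_halfPlaneToDisc (h₀ : ξ₀ ∈ rightHalfPlane) {ξ : ℂ} (h : ξ ∈ rightHalfPlane) :
    1 + halfPlaneToDisc ξ₀ ξ =
      ξ * ((starRingEnd ℂ) ξ₀ + ξ₀) / (ξ₀ * ((starRingEnd ℂ) ξ₀ + ξ)) := by
  have h1 := add_conj_ne_zero_of_mem_rightHalfPlane h h₀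
  have h2 := ne_zero_of_mem_rightHalfPlane h₀
  rw [halfPlaneToDisc]
  field_simp
  ring

theorem discToHalfPlane_halfPlaneToDisc (h₀ : ξ₀ ∈ rightHalfPlane) {ξ : ℂ}
    (h : ξ ∈ rightHalfPlane) : discToHalfPlane ξ₀ (halfPlaneToDisc ξ₀ ξ) = ξ := by
  have h1 := add_conj_ne_zero_of_mem_rightHalfPlane h h₀
  have h2 := ne_zero_of_mem_rightHalfPlane h₀
  have h3 : (starRingEnd ℂ) ξ₀ ≠ 0 := by simpa using h2
  rw [discToHalfPlane, div_eq_iff (discToHalfPlane_denom_ne_zero h₀ (halfPlaneToDisc_mem h₀ h)),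
    one_add_halfPlaneToDisc h₀ h, halfPlaneToDisc]
  field_simp
  ring

end DiscToHalfPlane

/-- The value and the first two derivatives of `h ∘ discToHalfPlane ξ₀` at `0`. -/
theorem derivs_comp_discToHalfPlane {h : ℂ → ℂ} (hh : DifferentiableOn ℂ h rightHalfPlane)
    {ξ₀ : ℂ} (h₀ : ξ₀ ∈ rightHalfPlane) :
    DifferentiableOn ℂ (h ∘ discToHalfPlane ξ₀) (Metric.ball 0 1) ∧
    (h ∘ discToHalfPlane ξ₀) 0 = h ξ₀ ∧
    deriv (h ∘ discToHalfPlane ξ₀) 0 =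
      deriv h ξ₀ * (ξ₀ * ((starRingEnd ℂ) ξ₀ + ξ₀) / (starRingEnd ℂ) ξ₀) ∧
    deriv (deriv (h ∘ discToHalfPlane ξ₀)) 0 =
      deriv (deriv h) ξ₀ * (ξ₀ * ((starRingEnd ℂ) ξ₀ + ξ₀) / (starRingEnd ℂ) ξ₀) ^ 2 +
      deriv h ξ₀ * (2 * ξ₀ ^ 2 * ((starRingEnd ℂ) ξ₀ + ξ₀) / (starRingEnd ℂ) ξ₀ ^ 2) := by
  have hO := isOpen_rightHalfPlane
  have hc : (starRingEnd ℂ) ξ₀ ≠ 0 := by simpa using ne_zero_of_mem_rightHalfPlane h₀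
  have hb : (0 : ℂ) ∈ Metric.ball (0 : ℂ) 1 := by simp
  have hd : ∀ z ∈ Metric.ball (0 : ℂ) 1, HasDerivAt (h ∘ discToHalfPlane ξ₀)
      (deriv h (discToHalfPlane ξ₀ z) * (ξ₀ * (starRingEnd ℂ) ξ₀ * ((starRingEnd ℂ) ξ₀ + ξ₀) /
      ((starRingEnd ℂ) ξ₀ - ξ₀ * z) ^ 2)) z := fun z hz =>
    ((hh.differentiableAt (hO.mem_nhds (discToHalfPlane_mem h₀ hz))).hasDerivAt).comp z
      (hasDerivAt_discToHalfPlane h₀ hz)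
  have e1 : ξ₀ * (starRingEnd ℂ) ξ₀ * ((starRingEnd ℂ) ξ₀ + ξ₀) / ((starRingEnd ℂ) ξ₀) ^ 2 =
      ξ₀ * ((starRingEnd ℂ) ξ₀ + ξ₀) / (starRingEnd ℂ) ξ₀ := by field_simp
  refine ⟨fun z hz => (hd z hz).differentiableAt.differentiableWithinAt,
    congrArg h (discToHalfPlane_zero h₀), ?_, ?_⟩
  · rw [(hd 0 hb).deriv, discToHalfPlane_zero h₀, mul_zero, sub_zero, e1]
  · have hev : deriv (h ∘ discToHalfPlane ξ₀) =ᶠ[𝓝 0] fun z => deriv h (discToHalfPlane ξ₀ z) *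
        (ξ₀ * (starRingEnd ℂ) ξ₀ * ((starRingEnd ℂ) ξ₀ + ξ₀) /
        ((starRingEnd ℂ) ξ₀ - ξ₀ * z) ^ 2) := by
      filter_upwards [Metric.ball_mem_nhds (0 : ℂ) one_pos] with z hz using (hd z hz).deriv
    rw [hev.deriv_eq]
    have h2 := (((hh.deriv hO).differentiableAt (hO.mem_nhds
      (discToHalfPlane_mem h₀ hb))).hasDerivAt).comp 0 (hasDerivAt_discToHalfPlane h₀ hb)
    have h3 := (h2.mul (hasDerivAt_deriv_discToHalfPlane h₀)).deriv
    refine Eq.trans h3 ?_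
    simp only [Function.comp, discToHalfPlane_zero h₀, mul_zero, sub_zero, e1]
    ring

/-- The strip `|im w| < π / 2`, mapped by `exp` onto the right half-plane. -/
def logStrip : Set ℂ := {w | w.im ∈ Ioo (-(π / 2)) (π / 2)}

theorem isOpen_logStrip : IsOpen logStrip := isOpen_Ioo.preimage Complex.continuous_im

theorem cos_pos_of_mem_logStrip {w : ℂ} (hw : w ∈ logStrip) : 0 < Real.cos w.im :=
  Real.cos_pos_of_mem_Ioo hw

theorem exp_mem_rightHalfPlane {w : ℂ} (hw : w ∈ logStrip) :
    Complex.exp w ∈ rightHalfPlane := by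
  change 0 < (Complex.exp w).re
  rw [Complex.exp_re]
  exact mul_pos (Real.exp_pos _) (cos_pos_of_mem_logStrip hw)

theorem log_mem_logStrip {ξ : ℂ} (h : ξ ∈ rightHalfPlane) : Complex.log ξ ∈ logStrip := by
  change (Complex.log ξ).im ∈ Ioo (-(π / 2)) (π / 2)
  rw [Complex.log_im]
  exact abs_lt.1 (Complex.abs_arg_lt_pi_div_two_iff.2 (Or.inl h))

/-- The function `f` in the logarithmic coordinate. -/
noncomputable def logLift (f : ℂ → ℂ) (w : ℂ) : ℂ := f (Complex.exp w)

namespace IsRogers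

variable {f : ℂ → ℂ}

theorem differentiableOn_div (hf : IsRogers f) :
    DifferentiableOn ℂ (fun ξ => f ξ / ξ) rightHalfPlane :=
  hf.holo.div differentiableOn_id fun _ h => ne_zero_of_mem_rightHalfPlane h

theorem differentiableOn_logLift (hf : IsRogers f) : DifferentiableOn ℂ (logLift f) logStrip :=
  hf.holo.comp Complex.differentiable_exp.differentiableOn fun _ h => exp_mem_rightHalfPlane h

theorem derivs_logLift (hf : IsRogers f) {w : ℂ} (hw : w ∈ logStrip) :
    logLift f w = Complex.exp w * (f (Complex.exp w) / Complex.exp w) ∧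
    deriv (logLift f) w = Complex.exp w * (f (Complex.exp w) / Complex.exp w +
      Complex.exp w * deriv (fun ξ => f ξ / ξ) (Complex.exp w)) ∧
    deriv (deriv (logLift f)) w = Complex.exp w * (f (Complex.exp w) / Complex.exp w +
      3 * (Complex.exp w * deriv (fun ξ => f ξ / ξ) (Complex.exp w)) +
      Complex.exp w ^ 2 * deriv (deriv (fun ξ => f ξ / ξ)) (Complex.exp w)) := by
  set h : ℂ → ℂ := fun ξ => f ξ / ξ with hdef
  have hO := isOpen_rightHalfPlane
  have hh : DifferentiableOn ℂ h rightHalfPlane := hf.differentiableOn_div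
  have e0 : ∀ v, logLift f v = Complex.exp v * h (Complex.exp v) := fun v => by
    rw [logLift, hdef]; field_simp [Complex.exp_ne_zero v]
  have e1 : ∀ v ∈ logStrip, HasDerivAt (fun v => h (Complex.exp v))
      (deriv h (Complex.exp v) * Complex.exp v) v := fun v hv =>
    (hh.differentiableAt (hO.mem_nhds (exp_mem_rightHalfPlane hv))).hasDerivAt.comp v
      (Complex.hasDerivAt_exp v)
  have e2 : ∀ v ∈ logStrip, HasDerivAt (fun v => deriv h (Complex.exp v))
      (deriv (deriv h) (Complex.exp v) * Complex.exp v) v := fun v hv =>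
    ((hh.deriv hO).differentiableAt (hO.mem_nhds (exp_mem_rightHalfPlane hv))).hasDerivAt.comp v
      (Complex.hasDerivAt_exp v)
  have e3 : ∀ v ∈ logStrip, deriv (logLift f) v =
      Complex.exp v * (h (Complex.exp v) + Complex.exp v * deriv h (Complex.exp v)) := by
    intro v hv
    have := ((Complex.hasDerivAt_exp v).mul (e1 v hv)).congr_of_eventuallyEq
      (f₁ := logLift f) (Eventually.of_forall e0)
    rw [this.deriv]; ring
  refine ⟨e0 w, e3 w hw, ?_⟩
  have hev : deriv (logLift f) =ᶠ[𝓝 w] fun v =>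
      Complex.exp v * (h (Complex.exp v) + Complex.exp v * deriv h (Complex.exp v)) := by
    filter_upwards [isOpen_logStrip.mem_nhds hw] with v hv using e3 v hv
  rw [hev.deriv_eq]
  have := ((Complex.hasDerivAt_exp w).mul ((e1 w hw).add
    ((Complex.hasDerivAt_exp w).mul (e2 w hw)))).deriv
  refine Eq.trans this ?_
  simp only [Pi.add_apply, Pi.mul_apply]
  ring

end IsRogers

/-- `cos² α` times the derivative in `α` of `im F (R + i α) / cos α`, where `F = logLift f`. -/
noncomputable def angularSlope (f : ℂ → ℂ) (w : ℂ) : ℝ :=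
  Real.cos w.im * (deriv (logLift f) w).re + Real.sin w.im * (logLift f w).im

theorem conj_exp_add_exp (w : ℂ) : (starRingEnd ℂ) (Complex.exp w) + Complex.exp w =
    (2 * Real.cos w.im * (Real.cos w.im + Real.sin w.im * Complex.I)) *
      (starRingEnd ℂ) (Complex.exp w) := by
  have hcs := Real.sin_sq_add_cos_sq w.im
  have hre := Complex.exp_re w
  have him := Complex.exp_im w
  apply Complex.ext <;>
  simp only [Complex.add_re, Complex.add_im, Complex.conj_re, Complex.conj_im, hre, him,
    Complex.mul_re, Complex.mul_im, Complex.ofReal_re, Complex.ofReal_im, Complex.I_re,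
    Complex.I_im, Complex.re_ofNat, Complex.im_ofNat]
  · linear_combination -(2 * Real.exp w.re * Real.cos w.im) * hcs
  · ring

theorem exp_eq_mul_conj_exp (w : ℂ) : Complex.exp w =
    (Real.cos w.im + Real.sin w.im * Complex.I) ^ 2 * (starRingEnd ℂ) (Complex.exp w) := by
  have hcs := Real.sin_sq_add_cos_sq w.im
  have hre := Complex.exp_re w
  have him := Complex.exp_im w
  apply Complex.ext <;>
  simp only [sq, Complex.add_re, Complex.add_im, Complex.conj_re, Complex.conj_im, hre, him,
    Complex.mul_re, Complex.mul_im, Complex.ofReal_re, Complex.ofReal_im, Complex.I_re,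
    Complex.I_im]
  · linear_combination -(Real.exp w.re * Real.cos w.im) * hcs
  · linear_combination -(Real.exp w.re * Real.sin w.im) * hcs

namespace IsRogers

variable {f : ℂ → ℂ}

theorem angularSlope_eq (hf : IsRogers f) {w : ℂ} (hw : w ∈ logStrip) :
    Real.exp w.re * (((f (Complex.exp w) / Complex.exp w)).re +
      (deriv ((fun ξ => f ξ / ξ) ∘ discToHalfPlane (Complex.exp w)) 0).re / 2) =
      angularSlope f w := by
  obtain ⟨d0, d1, d2⟩ := hf.derivs_logLift hw
  obtain ⟨-, -, hD1, -⟩ := derivs_comp_discToHalfPlane hf.differentiableOn_div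
    (exp_mem_rightHalfPlane hw)
  rw [angularSlope, d0, d1, hD1]
  set b := Complex.exp w * deriv (fun ξ => f ξ / ξ) (Complex.exp w) with hb
  set a := f (Complex.exp w) / Complex.exp w
  have hcs := Real.sin_sq_add_cos_sq w.im
  have hre := Complex.exp_re w
  have him := Complex.exp_im w
  have hω : deriv (fun ξ => f ξ / ξ) (Complex.exp w) * (Complex.exp w *
      ((starRingEnd ℂ) (Complex.exp w) + Complex.exp w) / (starRingEnd ℂ) (Complex.exp w)) =
      b * (2 * Real.cos w.im * (Real.cos w.im + Real.sin w.im * Complex.I)) := by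
    have hc : (starRingEnd ℂ) (Complex.exp w) ≠ 0 := by simp [Complex.exp_ne_zero]
    rw [conj_exp_add_exp, hb]; field_simp
  rw [hω]
  simp only [Complex.add_re, Complex.add_im, Complex.mul_re, Complex.mul_im, Complex.ofReal_re,
    Complex.ofReal_im, Complex.I_re, Complex.I_im, Complex.re_ofNat, Complex.im_ofNat, hre, him]
  linear_combination -(Real.exp w.re * a.re) * hcs

theorem re_comp_discToHalfPlane_nonneg (hf : IsRogers f) {w : ℂ} (hw : w ∈ logStrip) :
    ∀ z ∈ Metric.ball (0 : ℂ) 1,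
      0 ≤ (((fun ξ => f ξ / ξ) ∘ discToHalfPlane (Complex.exp w)) z).re := fun _ hz =>
  hf.re_nonneg _ (discToHalfPlane_mem (exp_mem_rightHalfPlane hw) hz)

/-- The estimate behind all the properties of the spine: the combinations of the derivatives of
`F = logLift f` up to the second order on the left are, up to the correction `sin α * B`,
components of a complex number which is at most `2 * B` in absolute value, `B` being the angular
slope. -/
theorem exists_gradient_angularSlope (hf : IsRogers f) {w : ℂ} (hw : w ∈ logStrip) :
    0 ≤ angularSlope f w ∧ ∃ X Y : ℝ, X ^ 2 + Y ^ 2 ≤ (2 * angularSlope f w) ^ 2 ∧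
      Real.cos w.im * (Real.cos w.im * (deriv (deriv (logLift f)) w).re +
        Real.sin w.im * (deriv (logLift f) w).im) = X ∧
      Real.cos w.im ^ 2 * ((deriv (deriv (logLift f)) w).im - (logLift f w).im) =
        Y + Real.sin w.im * angularSlope f w := by
  have hB := hf.angularSlope_eq hw
  obtain ⟨d0, d1, d2⟩ := hf.derivs_logLift hw
  obtain ⟨hH, hH0, hD1, hD2⟩ := derivs_comp_discToHalfPlane hf.differentiableOn_div
    (exp_mem_rightHalfPlane hw)
  have hle := norm_second_order_le hH (hf.re_comp_discToHalfPlane_nonneg hw)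
  rw [hH0] at hle
  set H := (fun ξ => f ξ / ξ) ∘ discToHalfPlane (Complex.exp w) with hHdef
  set r := Real.exp w.re with hr
  have hr0 : 0 < r := Real.exp_pos _
  have hle' : r * ‖(((f (Complex.exp w) / Complex.exp w).re : ℝ) : ℂ) + deriv H 0 +
      deriv (deriv H) 0 / 4‖ ≤ 2 * angularSlope f w := by
    rw [← hB]; nlinarith
  refine ⟨by nlinarith [norm_nonneg ((((f (Complex.exp w) / Complex.exp w).re : ℝ) : ℂ) +
    deriv H 0 + deriv (deriv H) 0 / 4)], ?_⟩
  set b := Complex.exp w * deriv (fun ξ => f ξ / ξ) (Complex.exp w) with hb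
  set d := Complex.exp w ^ 2 * deriv (deriv (fun ξ => f ξ / ξ)) (Complex.exp w) with hd
  set a := f (Complex.exp w) / Complex.exp w with ha
  have hcs := Real.sin_sq_add_cos_sq w.im
  have hre := Complex.exp_re w
  have him := Complex.exp_im w
  set c := Real.cos w.im with hc
  set s := Real.sin w.im with hs
  have hcon : (starRingEnd ℂ) (Complex.exp w) ≠ 0 := by simp [Complex.exp_ne_zero]
  have hcs' : (s : ℂ) ^ 2 + (c : ℂ) ^ 2 = 1 := by exact_mod_cast hcs
  have hsum : (starRingEnd ℂ) (Complex.exp w) + Complex.exp w =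
      2 * c * (c + s * Complex.I) * (starRingEnd ℂ) (Complex.exp w) := conj_exp_add_exp w
  have hD1' : deriv H 0 = b * (2 * c * (c + s * Complex.I)) := by
    rw [hD1, hsum, hb]; field_simp
  have hD2' : deriv (deriv H) 0 = d * (2 * c * (c + s * Complex.I)) ^ 2 +
      b * (2 * (c + s * Complex.I) ^ 2 * (2 * c * (c + s * Complex.I))) := by
    rw [hD2, hsum, hb, hd]
    have e : (2 * Complex.exp w ^ 2 * (2 * (c : ℂ) * (c + s * Complex.I) *
        (starRingEnd ℂ) (Complex.exp w)) / (starRingEnd ℂ) (Complex.exp w) ^ 2) =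
        2 * Complex.exp w * (2 * c * (c + s * Complex.I)) *
        (Complex.exp w / (starRingEnd ℂ) (Complex.exp w)) := by field_simp
    have e' : Complex.exp w / (starRingEnd ℂ) (Complex.exp w) = (c + s * Complex.I) ^ 2 := by
      rw [div_eq_iff hcon]; exact exp_eq_mul_conj_exp w
    rw [e, e']; field_simp
  -- the quantity bounded by `norm_second_order_le`, rotated by `-w.im` so that its components are
  -- the two combinations
  let q : ℂ := r * ((c - s * Complex.I) * (a.re + deriv H 0 + deriv (deriv H) 0 / 4))
  have hq : ‖q‖ ≤ 2 * angularSlope f w := by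
    have hrot : ‖(c - s * Complex.I : ℂ)‖ = 1 := by
      rw [← sq_eq_sq₀ (norm_nonneg _) zero_le_one, Complex.sq_norm, Complex.normSq_apply]
      simp
      linear_combination hcs
    rw [norm_mul, norm_mul, hrot, one_mul, Complex.norm_real, Real.norm_of_nonneg hr0.le]
    exact hle'
  have hq' : q = r * (a.re * (c - s * Complex.I) + 2 * c * b + c ^ 2 * (c + s * Complex.I) * d +
      c * (c + s * Complex.I) ^ 2 * b) := by
    simp only [q, hD1', hD2']
    have : (c - s * Complex.I : ℂ) * (c + s * Complex.I) = 1 := by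
      linear_combination hcs' - (s : ℂ) ^ 2 * Complex.I_sq
    linear_combination (r * (2 * c * b + c ^ 2 * (c + s * Complex.I) * d +
      c * (c + s * Complex.I) ^ 2 * b)) * this
  refine ⟨q.re, q.im, ?_, ?_, ?_⟩
  · have := Complex.sq_norm q
    rw [Complex.normSq_apply] at this
    have h2 := pow_le_pow_left₀ (norm_nonneg _) hq 2
    nlinarith
  · rw [hq', d1, d2]
    simp only [sq, Complex.add_re, Complex.add_im, Complex.sub_re, Complex.sub_im, Complex.mul_re,
      Complex.mul_im, Complex.ofReal_re, Complex.ofReal_im, Complex.I_re, Complex.I_im,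
      Complex.re_ofNat, Complex.im_ofNat, hre, him]
    linear_combination (r * c * a.re + 2 * r * c * b.re) * hcs
  · rw [angularSlope, hq', d0, d1, d2]
    simp only [sq, Complex.add_re, Complex.add_im, Complex.sub_re, Complex.sub_im, Complex.mul_re,
      Complex.mul_im, Complex.ofReal_re, Complex.ofReal_im, Complex.I_re, Complex.I_im,
      Complex.re_ofNat, Complex.im_ofNat, hre, him]
    linear_combination (-(r * s * a.re) + 2 * r * c * b.im) * hcs

/-- The degenerate Rogers functions: if the angular slope vanishes somewhere, then
`f ξ = κ + i k ξ`. -/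
theorem eq_affine_of_angularSlope_eq_zero (hf : IsRogers f) {w : ℂ} (hw : w ∈ logStrip)
    (h0 : angularSlope f w = 0) :
    ∃ κ k : ℝ, ∀ ξ ∈ rightHalfPlane, f ξ = κ + k * Complex.I * ξ := by
  have hB := hf.angularSlope_eq hw
  have h₀ := exp_mem_rightHalfPlane hw
  obtain ⟨hH, hH0, -, -⟩ := derivs_comp_discToHalfPlane hf.differentiableOn_div h₀
  have hz := fun z hz => eq_div_of_re_circleMultiplier_eq_zero hH
    (hf.re_comp_discToHalfPlane_nonneg hw) (by
      rw [hH0]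
      rw [h0] at hB
      exact (mul_eq_zero.1 hB).resolve_left (Real.exp_pos _).ne') (z := z) hz
  set ξ₀ := Complex.exp w
  set a := f ξ₀ / ξ₀
  have hx : (ξ₀.re : ℂ) ≠ 0 := by
    have : 0 < ξ₀.re := h₀
    exact_mod_cast this.ne'
  refine ⟨Complex.normSq ξ₀ * a.re / ξ₀.re, (a * ξ₀).im / ξ₀.re, fun ξ hξ => ?_⟩
  have h := hz _ (halfPlaneToDisc_mem h₀ hξ)
  have hξ0 := ne_zero_of_mem_rightHalfPlane hξ
  have hξ₀0 := ne_zero_of_mem_rightHalfPlane h₀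
  have hne := add_conj_ne_zero_of_mem_rightHalfPlane hξ h₀
  rw [one_add_halfPlaneToDisc h₀ hξ, hH0, Function.comp, discToHalfPlane_halfPlaneToDisc h₀ hξ,
    halfPlaneToDisc] at h
  field_simp at h
  have e1 : (starRingEnd ℂ) ξ₀ + ξ₀ = 2 * ξ₀.re := by
    rw [add_comm, Complex.add_conj]; push_cast; ring
  have e2 : ξ₀ * (starRingEnd ℂ) ξ₀ = Complex.normSq ξ₀ := Complex.mul_conj _
  have e3 : a + (starRingEnd ℂ) a = 2 * a.re := by rw [Complex.add_conj]; push_cast; ring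
  have e4 : a * ξ₀ - (starRingEnd ℂ) a * (starRingEnd ℂ) ξ₀ =
      2 * ((a * ξ₀).im : ℝ) * Complex.I := by
    rw [← map_mul, Complex.sub_conj]; push_cast; ring
  push_cast
  field_simp
  rw [e1] at h
  linear_combination h / 2 + Complex.normSq ξ₀ * e3 / 2 + (a + (starRingEnd ℂ) a) * e2 / 2 +
    ξ * e4 / 2

end IsRogers

/-! ### Derivatives along the coordinate lines of the strip -/

/-- The point `R + i α`. -/
def stripPoint (R α : ℝ) : ℂ := ⟨R, α⟩

@[simp] theorem stripPoint_re (R α : ℝ) : (stripPoint R α).re = R := rfl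

@[simp] theorem stripPoint_im (R α : ℝ) : (stripPoint R α).im = α := rfl

theorem stripPoint_eta (w : ℂ) : stripPoint w.re w.im = w := rfl

theorem stripPoint_mem {R α : ℝ} : stripPoint R α ∈ logStrip ↔ α ∈ Ioo (-(π / 2)) (π / 2) :=
  Iff.rfl

theorem stripPoint_eq (R α : ℝ) : stripPoint R α = R + α * Complex.I :=
  (Complex.mk_eq_add_mul_I R α)

theorem hasDerivAt_stripPoint {γ : ℝ → ℝ} {R m : ℝ} (hγ : HasDerivAt γ m R) :
    HasDerivAt (fun x => stripPoint x (γ x)) (1 + m * Complex.I) R := by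
  simp only [stripPoint_eq]
  exact (HasDerivAt.ofReal_comp (hasDerivAt_id R)).add ((hγ.ofReal_comp).mul_const _)

theorem hasDerivAt_stripPoint_right (R α : ℝ) :
    HasDerivAt (fun x => stripPoint R x) Complex.I α := by
  simp only [stripPoint_eq]
  simpa using ((HasDerivAt.ofReal_comp (hasDerivAt_id α)).mul_const Complex.I).const_add (R : ℂ)

theorem HasDerivAt.complex_re {g : ℝ → ℂ} {g' : ℂ} {x : ℝ} (h : HasDerivAt g g' x) :
    HasDerivAt (fun x => (g x).re) g'.re x :=
  Complex.reCLM.hasFDerivAt.comp_hasDerivAt x h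

theorem HasDerivAt.complex_im {g : ℝ → ℂ} {g' : ℂ} {x : ℝ} (h : HasDerivAt g g' x) :
    HasDerivAt (fun x => (g x).im) g'.im x :=
  Complex.imCLM.hasFDerivAt.comp_hasDerivAt x h

theorem HasDerivAt.comp_ofReal_curve {G : ℂ → ℂ} {G' : ℂ} {γ : ℝ → ℂ} {γ' : ℂ} {x : ℝ}
    (hG : HasDerivAt G G' (γ x)) (hγ : HasDerivAt γ γ' x) :
    HasDerivAt (fun x => G (γ x)) (G' * γ') x := by
  have := hG.scomp x hγ
  rw [smul_eq_mul, mul_comm] at this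
  exact this

namespace IsRogers

variable {f : ℂ → ℂ}

theorem hasDerivAt_logLift (hf : IsRogers f) {w : ℂ} (hw : w ∈ logStrip) :
    HasDerivAt (logLift f) (deriv (logLift f) w) w :=
  (hf.differentiableOn_logLift.differentiableAt (isOpen_logStrip.mem_nhds hw)).hasDerivAt

theorem hasDerivAt_deriv_logLift (hf : IsRogers f) {w : ℂ} (hw : w ∈ logStrip) :
    HasDerivAt (deriv (logLift f)) (deriv (deriv (logLift f)) w) w :=
  ((hf.differentiableOn_logLift.deriv isOpen_logStrip).differentiableAt
    (isOpen_logStrip.mem_nhds hw)).hasDerivAt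

theorem hasDerivAt_im_logLift_div_cos (hf : IsRogers f) {R α : ℝ}
    (hα : α ∈ Ioo (-(π / 2)) (π / 2)) :
    HasDerivAt (fun x => (logLift f (stripPoint R x)).im / Real.cos x)
      (angularSlope f (stripPoint R α) / Real.cos α ^ 2) α := by
  have h1 := ((hf.hasDerivAt_logLift (stripPoint_mem (R := R).2 hα)).comp_ofReal_curve
    (hasDerivAt_stripPoint_right R α)).complex_im
  refine (h1.div (Real.hasDerivAt_cos α) (Real.cos_pos_of_mem_Ioo hα).ne').congr_deriv ?_
  simp only [angularSlope, Complex.mul_im, Complex.I_re, Complex.I_im, stripPoint_im]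
  ring

theorem hasDerivAt_angularSlope (hf : IsRogers f) {R α : ℝ}
    (hα : α ∈ Ioo (-(π / 2)) (π / 2)) :
    HasDerivAt (fun x => angularSlope f (stripPoint R x))
      (-(Real.cos α * ((deriv (deriv (logLift f)) (stripPoint R α)).im -
        (logLift f (stripPoint R α)).im))) α := by
  have h1 := ((hf.hasDerivAt_logLift (stripPoint_mem (R := R).2 hα)).comp_ofReal_curve
    (hasDerivAt_stripPoint_right R α)).complex_im
  have h2 := ((hf.hasDerivAt_deriv_logLift (stripPoint_mem (R := R).2 hα)).comp_ofReal_curve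
    (hasDerivAt_stripPoint_right R α)).complex_re
  refine (((Real.hasDerivAt_cos α).mul h2).add ((Real.hasDerivAt_sin α).mul h1)).congr_deriv ?_
  simp only [Complex.mul_im, Complex.mul_re, Complex.I_re, Complex.I_im]
  ring

theorem strictMonoOn_im_logLift_div_cos (hf : IsRogers f)
    (hB : ∀ w ∈ logStrip, 0 < angularSlope f w) (R : ℝ) :
    StrictMonoOn (fun x => (logLift f (stripPoint R x)).im / Real.cos x)
      (Ioo (-(π / 2)) (π / 2)) := by
  refine strictMonoOn_of_deriv_pos (convex_Ioo _ _) (fun x hx =>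
    (hf.hasDerivAt_im_logLift_div_cos hx).continuousAt.continuousWithinAt) fun x hx => ?_
  rw [interior_Ioo] at hx
  rw [(hf.hasDerivAt_im_logLift_div_cos hx).deriv]
  exact div_pos (hB _ hx) (pow_pos (Real.cos_pos_of_mem_Ioo hx) 2)

end IsRogers

/-! ### The angle of the spine -/

/-- `ϑ R` is the angle at which the circle of radius `exp R` meets the spine, or `± π / 2` if it
does not meet it. -/
structure IsSpineAngle (f : ℂ → ℂ) (ϑ : ℝ → ℝ) : Prop where
  mem : ∀ R, ϑ R ∈ Icc (-(π / 2)) (π / 2)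
  sign : ∀ w ∈ logStrip, SignType.sign (logLift f w).im = SignType.sign (w.im - ϑ w.re)

theorem exists_sign_eq_sign_sub {u : ℝ → ℝ} {a b : ℝ} (hab : a ≤ b)
    (hu : StrictMonoOn u (Ioo a b)) (hc : ContinuousOn u (Ioo a b)) :
    ∃ θ ∈ Icc a b, ∀ x ∈ Ioo a b, SignType.sign (u x) = SignType.sign (x - θ) := by
  let S : Set ℝ := insert a {x | x ∈ Ioo a b ∧ u x < 0}
  have hne : S.Nonempty := ⟨a, mem_insert _ _⟩
  have hbd : ∀ x ∈ S, x ≤ b := by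
    rintro x (rfl | hx)
    · exact hab
    · exact hx.1.2.le
  have hbdd : BddAbove S := ⟨b, hbd⟩
  have hlow : ∀ x ∈ Ioo a b, x < sSup S → u x < 0 := by
    intro x hx hlt
    obtain ⟨y, hy, hxy⟩ := exists_lt_of_lt_csSup hne hlt
    rcases hy with rfl | hy
    · exact absurd hxy hx.1.not_gt
    · exact (hu hx hy.1 hxy).trans hy.2
  have hhigh : ∀ x ∈ Ioo a b, sSup S < x → 0 ≤ u x := by
    intro x hx hlt
    by_contra h
    exact absurd (le_csSup hbdd (mem_insert_of_mem _ ⟨hx, not_le.1 h⟩)) hlt.not_ge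
  refine ⟨sSup S, ⟨le_csSup hbdd (mem_insert _ _), csSup_le hne hbd⟩, fun x hx => ?_⟩
  rcases lt_trichotomy x (sSup S) with h | h | h
  · rw [sign_neg (hlow x hx h), sign_neg (sub_neg.2 h)]
  · have hcx := hc.continuousAt (Ioo_mem_nhds hx.1 hx.2)
    have h0 : u x = 0 := by
      apply le_antisymm
      · refine le_of_tendsto (hcx.tendsto.mono_left (nhdsWithin_le_nhds (s := Iio x))) ?_
        filter_upwards [Ioo_mem_nhdsLT hx.1] with y hy
        exact (hlow y ⟨hy.1, hy.2.trans hx.2⟩ (h ▸ hy.2)).le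
      · refine ge_of_tendsto (hcx.tendsto.mono_left (nhdsWithin_le_nhds (s := Ioi x))) ?_
        filter_upwards [Ioo_mem_nhdsGT hx.2] with y hy
        exact hhigh y ⟨hx.1.trans hy.1, hy.2⟩ (h ▸ hy.1)
    rw [h0, ← h, sub_self]
  · obtain ⟨y, hy1, hy2⟩ := exists_between h
    have hya : a < y := (le_csSup hbdd (mem_insert _ _)).trans_lt hy1
    have : 0 < u x := (hhigh y ⟨hya, hy2.trans hx.2⟩ hy1).trans_lt
      (hu ⟨hya, hy2.trans hx.2⟩ hx hy2)
    rw [sign_pos this, sign_pos (sub_pos.2 h)]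

theorem IsRogers.exists_isSpineAngle {f : ℂ → ℂ} (hf : IsRogers f)
    (hB : ∀ w ∈ logStrip, 0 < angularSlope f w) : ∃ ϑ, IsSpineAngle f ϑ := by
  have h : ∀ R : ℝ, ∃ θ ∈ Icc (-(π / 2)) (π / 2), ∀ x ∈ Ioo (-(π / 2)) (π / 2),
      SignType.sign ((logLift f (stripPoint R x)).im / Real.cos x) = SignType.sign (x - θ) :=
    fun R => exists_sign_eq_sign_sub (by linarith [Real.pi_pos])
      (hf.strictMonoOn_im_logLift_div_cos hB R) (fun x hx =>
        (hf.hasDerivAt_im_logLift_div_cos hx).continuousAt.continuousWithinAt)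
  choose ϑ h1 h2 using h
  refine ⟨ϑ, h1, fun w hw => ?_⟩
  rw [← h2 w.re w.im hw, stripPoint_eta, div_eq_mul_inv, sign_mul,
    sign_pos (inv_pos.2 (cos_pos_of_mem_logStrip hw)), mul_one]

namespace IsSpineAngle

variable {f : ℂ → ℂ} {ϑ : ℝ → ℝ}

theorem im_neg_iff (h : IsSpineAngle f ϑ) {R α : ℝ} (hα : α ∈ Ioo (-(π / 2)) (π / 2)) :
    (logLift f (stripPoint R α)).im < 0 ↔ α < ϑ R := by
  have := h.sign _ (stripPoint_mem (R := R).2 hα)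
  rw [← sign_eq_neg_one_iff, this, sign_eq_neg_one_iff, stripPoint_im, stripPoint_re, sub_neg]

theorem im_pos_iff (h : IsSpineAngle f ϑ) {R α : ℝ} (hα : α ∈ Ioo (-(π / 2)) (π / 2)) :
    0 < (logLift f (stripPoint R α)).im ↔ ϑ R < α := by
  have := h.sign _ (stripPoint_mem (R := R).2 hα)
  rw [← sign_eq_one_iff, this, sign_eq_one_iff, stripPoint_im, stripPoint_re, sub_pos]

theorem im_eq_zero_iff (h : IsSpineAngle f ϑ) {R α : ℝ} (hα : α ∈ Ioo (-(π / 2)) (π / 2)) :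
    (logLift f (stripPoint R α)).im = 0 ↔ α = ϑ R := by
  have := h.sign _ (stripPoint_mem (R := R).2 hα)
  rw [← sign_eq_zero_iff, this, sign_eq_zero_iff, stripPoint_im, stripPoint_re, sub_eq_zero]

theorem unique (h : IsSpineAngle f ϑ) {ϑ' : ℝ → ℝ} (h' : IsSpineAngle f ϑ') : ϑ = ϑ' := by
  funext R
  by_contra hne
  wlog hlt : ϑ R < ϑ' R generalizing ϑ ϑ'
  · exact this h' h (Ne.symm hne) (lt_of_le_of_ne (not_lt.1 hlt) (Ne.symm hne))
  obtain ⟨α, h1, h2⟩ := exists_between hlt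
  have hα : α ∈ Ioo (-(π / 2)) (π / 2) :=
    ⟨(h.mem R).1.trans_lt h1, h2.trans_le (h'.mem R).2⟩
  exact lt_asymm ((h.im_pos_iff hα).2 h1) ((h'.im_neg_iff hα).2 h2)

theorem continuous (h : IsSpineAngle f ϑ) (hf : IsRogers f) : Continuous ϑ := by
  have hc : ∀ R α : ℝ, α ∈ Ioo (-(π / 2)) (π / 2) →
      ContinuousAt (fun x => (logLift f (stripPoint x α)).im) R := fun R α hα =>
    (HasDerivAt.comp_ofReal_curve (γ := fun x => stripPoint x α)
      (hf.hasDerivAt_logLift (stripPoint_mem (R := R).2 hα))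
      (hasDerivAt_stripPoint (hasDerivAt_const R α))).complex_im.continuousAt
  rw [continuous_iff_continuousAt]
  intro R
  rw [ContinuousAt, tendsto_order]
  constructor
  · intro a ha
    rcases lt_or_ge a (-(π / 2)) with h1 | h1
    · exact Eventually.of_forall fun x => h1.trans_le (h.mem x).1
    · obtain ⟨α, h2, h3⟩ := exists_between ha
      have hα : α ∈ Ioo (-(π / 2)) (π / 2) := ⟨h1.trans_lt h2, h3.trans_le (h.mem R).2⟩
      filter_upwards [(hc R α hα).eventually_lt continuousAt_const
        ((h.im_neg_iff hα).2 h3)] with x hx using h2.trans ((h.im_neg_iff hα).1 hx)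
  · intro a ha
    rcases lt_or_ge (π / 2) a with h1 | h1
    · exact Eventually.of_forall fun x => (h.mem x).2.trans_lt h1
    · obtain ⟨α, h2, h3⟩ := exists_between ha
      have hα : α ∈ Ioo (-(π / 2)) (π / 2) := ⟨(h.mem R).1.trans_lt h2, h3.trans_le h1⟩
      filter_upwards [continuousAt_const.eventually_lt (hc R α hα)
        ((h.im_pos_iff hα).2 h2)] with x hx using ((h.im_pos_iff hα).1 hx).trans h3

/-- On the set `{R | |ϑ R| < π / 2}` the real part of the derivative is positive at the points of
the nodal line. -/
theorem re_deriv_pos (h : IsSpineAngle f ϑ)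
    (hB : ∀ w ∈ logStrip, 0 < angularSlope f w) {R : ℝ} (hR : ϑ R ∈ Ioo (-(π / 2)) (π / 2)) :
    angularSlope f (stripPoint R (ϑ R)) =
      Real.cos (ϑ R) * (deriv (logLift f) (stripPoint R (ϑ R))).re ∧
    0 < (deriv (logLift f) (stripPoint R (ϑ R))).re := by
  have h0 := (h.im_eq_zero_iff hR).2 rfl
  have h1 : angularSlope f (stripPoint R (ϑ R)) =
      Real.cos (ϑ R) * (deriv (logLift f) (stripPoint R (ϑ R))).re := by
    rw [angularSlope, h0, stripPoint_im, mul_zero, add_zero]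
  have h2 := hB _ (stripPoint_mem (R := R).2 hR)
  rw [h1] at h2
  exact ⟨h1, pos_of_mul_pos_right h2 (Real.cos_pos_of_mem_Ioo hR).le⟩

theorem analyticAt (h : IsSpineAngle f ϑ) (hf : IsRogers f)
    (hB : ∀ w ∈ logStrip, 0 < angularSlope f w) {R : ℝ} (hR : ϑ R ∈ Ioo (-(π / 2)) (π / 2)) :
    AnalyticAt ℝ ϑ R := by
  set w := stripPoint R (ϑ R) with hw
  have hwS : w ∈ logStrip := hR
  -- the inverse function theorem is applied to `v ↦ re v + i im F v`, which straightens the spine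
  let Φ : ℂ → ℂ := fun v => stripPoint v.re (logLift f v).im
  have hF : AnalyticAt ℝ (logLift f) w :=
    (hf.differentiableOn_logLift.analyticAt (isOpen_logStrip.mem_nhds hwS)).restrictScalars
  have e : ∀ v, Φ v = Complex.ofRealCLM (Complex.reCLM v) +
      (Complex.imCLM.smulRight Complex.I : ℂ →L[ℝ] ℂ) (logLift f v) := fun v => by
    simp only [Φ, stripPoint_eq]; simp
  have hΦ : AnalyticAt ℝ Φ w := by
    rw [funext e]
    exact ((Complex.ofRealCLM.comp Complex.reCLM).analyticAt w).add
      (((Complex.imCLM.smulRight Complex.I : ℂ →L[ℝ] ℂ).analyticAt _).comp hF)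
  set d := deriv (logLift f) w with hd
  have hd0 : 0 < d.re := (h.re_deriv_pos hB hR).2
  let L : ℂ →L[ℝ] ℂ := Complex.ofRealCLM.comp Complex.reCLM +
    (Complex.imCLM.smulRight Complex.I : ℂ →L[ℝ] ℂ).comp (d • (1 : ℂ →L[ℝ] ℂ))
  have hL : HasFDerivAt Φ L w := by
    rw [funext e]
    exact ((Complex.ofRealCLM.comp Complex.reCLM).hasFDerivAt (x := w)).add
      (((Complex.imCLM.smulRight Complex.I : ℂ →L[ℝ] ℂ).hasFDerivAt).comp w
        (hf.hasDerivAt_logLift hwS).complexToReal_fderiv)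
  have hinj : Function.Injective (L : ℂ →ₗ[ℝ] ℂ) := by
    rw [injective_iff_map_eq_zero]
    intro v hv
    have hv' : (v.re : ℂ) + ((d * v).im : ℂ) * Complex.I = 0 := by
      simpa [L] using hv
    rw [← Complex.mk_eq_add_mul_I, Complex.ext_iff] at hv'
    obtain ⟨h1, h2⟩ := hv'
    simp only [Complex.zero_re, Complex.zero_im] at h1 h2
    rw [Complex.mul_im, h1, mul_zero, add_zero] at h2
    exact Complex.ext h1 ((mul_eq_zero.1 h2).resolve_left hd0.ne')
  let E : ℂ ≃L[ℝ] ℂ := (LinearEquiv.ofInjectiveEndo (L : ℂ →ₗ[ℝ] ℂ) hinj).toContinuousLinearEquiv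
  have hE : HasFDerivAt Φ (E : ℂ →L[ℝ] ℂ) w := by
    have : (E : ℂ →L[ℝ] ℂ) = L := by ext v; rfl
    rwa [this]
  have hcd : ContDiffAt ℝ ω Φ w := hΦ.contDiffAt
  have hne : (ω : WithTop ℕ∞) ≠ 0 := by simp
  have hinv : AnalyticAt ℝ (hcd.localInverse hE hne) (Φ w) :=
    (hcd.to_localInverse hE hne).analyticAt
  have hΦx : ∀ x, ϑ x ∈ Ioo (-(π / 2)) (π / 2) → Φ (stripPoint x (ϑ x)) = (x : ℂ) := fun x hx => by
    simp only [Φ, (h.im_eq_zero_iff hx).2 rfl, stripPoint_re]; rfl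
  have hcont := h.continuous hf
  have hev : ∀ᶠ x in 𝓝 R, ϑ x = (hcd.localInverse hE hne (x : ℂ)).im := by
    have hl : ∀ᶠ v in 𝓝 w, hcd.localInverse hE hne (Φ v) = v :=
      (hcd.hasStrictFDerivAt' hE hne).eventually_left_inverse
    have ht : ContinuousAt (fun x => stripPoint x (ϑ x)) R := by
      simp only [stripPoint_eq]
      fun_prop
    filter_upwards [ht.eventually hl, hcont.continuousAt.eventually_mem (isOpen_Ioo.mem_nhds hR)]
      with x hx hx2
    rw [hΦx x hx2] at hx
    rw [hx, stripPoint_im]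
  rw [hΦx R hR] at hinv
  exact ((Complex.imCLM.analyticAt _).comp
    (hinv.comp (Complex.ofRealCLM.analyticAt R))).congr (hev.mono fun x hx => hx.symm)

/-- The differential inequality for the angle of the spine. -/
theorem curvature_le (h : IsSpineAngle f ϑ) (hf : IsRogers f)
    (hB : ∀ w ∈ logStrip, 0 < angularSlope f w) {R : ℝ} (hR : ϑ R ∈ Ioo (-(π / 2)) (π / 2)) :
    |Real.cos (ϑ R) * deriv (deriv ϑ) R + Real.sin (ϑ R) * (1 + deriv ϑ R ^ 2)| ≤
      2 * (1 + deriv ϑ R ^ 2) := by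
  have hZ : ∀ᶠ x in 𝓝 R, ϑ x ∈ Ioo (-(π / 2)) (π / 2) :=
    (h.continuous hf).continuousAt.eventually_mem (isOpen_Ioo.mem_nhds hR)
  have hder : ∀ x, ϑ x ∈ Ioo (-(π / 2)) (π / 2) → HasDerivAt ϑ (deriv ϑ x) x := fun x hx =>
    (h.analyticAt hf hB hx).differentiableAt.hasDerivAt
  have hder2 : HasDerivAt (deriv ϑ) (deriv (deriv ϑ) R) R :=
    (h.analyticAt hf hB hR).deriv.differentiableAt.hasDerivAt
  -- the first derivative of `im F (R + i ϑ R) = 0`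
  have h1 : ∀ᶠ x in 𝓝 R, (deriv (logLift f) (stripPoint x (ϑ x))).im +
      deriv ϑ x * (deriv (logLift f) (stripPoint x (ϑ x))).re = 0 := by
    filter_upwards [hZ.eventually_nhds] with x hx
    have hx0 := hx.self_of_nhds
    have hd := (HasDerivAt.comp_ofReal_curve (γ := fun x => stripPoint x (ϑ x))
      (hf.hasDerivAt_logLift (stripPoint_mem.2 hx0))
      (hasDerivAt_stripPoint (hder x hx0))).complex_im
    have h0 : (fun x => (logLift f (stripPoint x (ϑ x))).im) =ᶠ[𝓝 x] fun _ => 0 := by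
      filter_upwards [hx] with y hy using (h.im_eq_zero_iff hy).2 rfl
    have := hd.unique ((hasDerivAt_const x (0 : ℝ)).congr_of_eventuallyEq h0)
    simp only [Complex.mul_im, Complex.add_re, Complex.add_im, Complex.one_re, Complex.one_im,
      Complex.mul_re, Complex.ofReal_re, Complex.ofReal_im, Complex.I_re, Complex.I_im] at this
    linarith
  have hw := stripPoint_mem (R := R).2 hR
  -- the second derivative
  have h2 : (deriv (deriv (logLift f)) (stripPoint R (ϑ R)) * (1 + deriv ϑ R * Complex.I)).im +
      (deriv (deriv ϑ) R * (deriv (logLift f) (stripPoint R (ϑ R))).re + deriv ϑ R *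
      (deriv (deriv (logLift f)) (stripPoint R (ϑ R)) * (1 + deriv ϑ R * Complex.I)).re) = 0 := by
    have hd := HasDerivAt.comp_ofReal_curve (γ := fun x => stripPoint x (ϑ x))
      (hf.hasDerivAt_deriv_logLift hw) (hasDerivAt_stripPoint (hder R hR))
    exact (hd.complex_im.add (hder2.mul hd.complex_re)).unique
      ((hasDerivAt_const R (0 : ℝ)).congr_of_eventuallyEq h1)
  have h1R := h1.self_of_nhds
  obtain ⟨hBA, hA⟩ := h.re_deriv_pos hB hR
  obtain ⟨-, X, Y, hXY, hX, hY⟩ := hf.exists_gradient_angularSlope hw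
  have h0 := (h.im_eq_zero_iff hR).2 rfl
  have hBpos := hB _ hw
  rw [stripPoint_im] at hX hY
  rw [h0, sub_zero] at hY
  simp only [Complex.mul_im, Complex.add_re, Complex.add_im, Complex.one_re, Complex.one_im,
    Complex.mul_re, Complex.ofReal_re, Complex.ofReal_im, Complex.I_re, Complex.I_im] at h2
  set B := angularSlope f (stripPoint R (ϑ R))
  set c := Real.cos (ϑ R)
  set s := Real.sin (ϑ R)
  set t := deriv ϑ R
  set t' := deriv (deriv ϑ) R
  set A := (deriv (logLift f) (stripPoint R (ϑ R))).re
  set A' := (deriv (logLift f) (stripPoint R (ϑ R))).im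
  set P := (deriv (deriv (logLift f)) (stripPoint R (ϑ R))).re
  set Q := (deriv (deriv (logLift f)) (stripPoint R (ϑ R))).im
  have key : B * (c * t' + s * (1 + t ^ 2)) = -(Y * (1 - t ^ 2) + 2 * t * X) := by
    linear_combination (c * t') * hBA + c ^ 2 * h2 - (1 - t ^ 2) * hY - 2 * t * hX +
      (2 * t * c * s) * h1R + (2 * t ^ 2 * s) * hBA
  have hsq : (B * (c * t' + s * (1 + t ^ 2))) ^ 2 ≤ (B * (2 * (1 + t ^ 2))) ^ 2 := by
    rw [key]
    nlinarith [sq_nonneg (X * (1 - t ^ 2) - 2 * t * Y), sq_nonneg (1 + t ^ 2),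
      mul_le_mul_of_nonneg_right hXY (sq_nonneg (1 + t ^ 2))]
  have habs := abs_le_of_sq_le_sq hsq (by positivity)
  rw [abs_mul, abs_of_pos hBpos] at habs
  exact le_of_mul_le_mul_left habs hBpos

end IsSpineAngle

/-! ### Monotone arcs of the spine -/

/-- A continuous angle, analytic where it lies strictly between `± π / 2`, whose graph satisfies the
differential inequality of `IsSpineAngle.curvature_le`. The class is invariant under the
reflections of the strip. -/
structure IsCurvatureBoundedAngle (ϑ : ℝ → ℝ) : Prop where
  mem : ∀ R, ϑ R ∈ Icc (-(π / 2)) (π / 2)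
  cont : Continuous ϑ
  analyticAt : ∀ R, ϑ R ∈ Ioo (-(π / 2)) (π / 2) → AnalyticAt ℝ ϑ R
  curvature_le : ∀ R, ϑ R ∈ Ioo (-(π / 2)) (π / 2) →
    |Real.cos (ϑ R) * deriv (deriv ϑ) R + Real.sin (ϑ R) * (1 + deriv ϑ R ^ 2)| ≤
      2 * (1 + deriv ϑ R ^ 2)

theorem IsSpineAngle.isCurvatureBoundedAngle {f : ℂ → ℂ} {ϑ : ℝ → ℝ} (h : IsSpineAngle f ϑ)
    (hf : IsRogers f) (hB : ∀ w ∈ logStrip, 0 < angularSlope f w) :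
    IsCurvatureBoundedAngle ϑ :=
  ⟨h.mem, h.continuous hf, fun _ hR => h.analyticAt hf hB hR, fun _ hR => h.curvature_le hf hB hR⟩

/-- Two angles in `[-π/2, π/2]` with close sines are close. -/
theorem sq_sub_le_of_sin_sub_le {a b : ℝ} (ha : -(π / 2) ≤ a) (hab : a ≤ b) (hb : b ≤ π / 2) :
    (b - a) ^ 2 ≤ 5 * (Real.sin b - Real.sin a) := by
  have hpi := Real.pi_pos
  set x := (b - a) / 2 with hx
  have hx0 : 0 ≤ x := by rw [hx]; linarith
  have hx1 : x ≤ π / 2 := by rw [hx]; linarith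
  have h1 : 2 / π * x ≤ Real.sin x := Real.mul_le_sin hx0 hx1
  have h2 : Real.sin x ≤ Real.cos ((b + a) / 2) := by
    rw [← Real.cos_pi_div_two_sub, ← Real.cos_abs ((b + a) / 2)]
    apply Real.cos_le_cos_of_nonneg_of_le_pi (abs_nonneg _) (by linarith)
    rw [abs_le, hx]
    constructor <;> linarith
  rw [Real.sin_sub_sin, ← hx]
  have h3 : 2 / π * x * (2 / π * x) ≤ Real.sin x * Real.cos ((b + a) / 2) := by
    have : 0 ≤ 2 / π * x := by positivity
    exact mul_le_mul h1 (h1.trans h2) this (this.trans h1)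
  have h4 : (2 / π * x) * (2 / π * x) * 10 ≥ 4 * x ^ 2 := by
    have h5 : π ^ 2 ≤ 10 := by nlinarith [Real.pi_lt_d2, Real.pi_gt_three]
    have e : (2 / π * x) * (2 / π * x) * 10 = 40 * x ^ 2 / π ^ 2 := by field_simp; ring
    rw [e, ge_iff_le, le_div_iff₀ (by positivity)]
    nlinarith [sq_nonneg x]
  have e : (b - a) ^ 2 = 4 * x ^ 2 := by rw [hx]; ring
  rw [e]
  linarith

namespace IsCurvatureBoundedAngle

variable {ϑ : ℝ → ℝ}

theorem neg (h : IsCurvatureBoundedAngle ϑ) : IsCurvatureBoundedAngle fun R => -ϑ R := by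
  have hI : ∀ R, -ϑ R ∈ Ioo (-(π / 2)) (π / 2) → ϑ R ∈ Ioo (-(π / 2)) (π / 2) := fun R hR =>
    ⟨by linarith [hR.2], by linarith [hR.1]⟩
  refine ⟨fun R => ⟨by linarith [(h.mem R).2], by linarith [(h.mem R).1]⟩, h.cont.neg,
    fun R hR => (h.analyticAt R (hI R hR)).neg, fun R hR => ?_⟩
  have e : deriv (fun R => -ϑ R) = fun R => -deriv ϑ R := by funext x; exact deriv.fun_neg
  have e2 : deriv (fun R => -deriv ϑ R) R = -deriv (deriv ϑ) R := deriv.fun_neg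
  have := h.curvature_le R (hI R hR)
  rw [← abs_neg] at this
  simp only [e, e2, Real.cos_neg, Real.sin_neg, neg_sq]
  refine Eq.trans_le (congrArg _ ?_) this
  ring

theorem comp_neg (h : IsCurvatureBoundedAngle ϑ) :
    IsCurvatureBoundedAngle fun R => ϑ (-R) := by
  refine ⟨fun R => h.mem _, h.cont.comp continuous_neg, fun R hR =>
    (h.analyticAt _ hR).fun_comp analyticAt_id.neg, fun R hR => ?_⟩
  have e : deriv (fun R => ϑ (-R)) = fun R => -deriv ϑ (-R) := by
    funext x; exact deriv_comp_neg ϑ x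
  have e2 : deriv (fun R => -deriv ϑ (-R)) R = deriv (deriv ϑ) (-R) := by
    rw [deriv.fun_neg, deriv_comp_neg (deriv ϑ) R, neg_neg]
  simp only [e, e2, neg_sq]
  exact h.curvature_le _ hR

theorem hasDerivAt (h : IsCurvatureBoundedAngle ϑ) {R : ℝ} (hR : ϑ R ∈ Ioo (-(π / 2)) (π / 2)) :
    HasDerivAt ϑ (deriv ϑ R) R :=
  (h.analyticAt R hR).differentiableAt.hasDerivAt

theorem hasDerivAt_deriv (h : IsCurvatureBoundedAngle ϑ) {R : ℝ}
    (hR : ϑ R ∈ Ioo (-(π / 2)) (π / 2)) : HasDerivAt (deriv ϑ) (deriv (deriv ϑ) R) R :=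
  (h.analyticAt R hR).deriv.differentiableAt.hasDerivAt

/-- An increasing arc that starts horizontally at an angle of at least `-π / 6` has a bounded mean
slope: the second derivative of `-1 / (1 + sin ϑ)` is bounded above. -/
theorem sub_le_of_deriv_eq_zero (h : IsCurvatureBoundedAngle ϑ) {a b : ℝ} (hab : a < b)
    (hmono : MonotoneOn ϑ (Icc a b)) (hI : ∀ R ∈ Ioo a b, ϑ R ∈ Ioo (-(π / 2)) (π / 2))
    (ha : ϑ a ∈ Ioo (-(π / 2)) (π / 2)) (ha0 : deriv ϑ a = 0) (has : -(1 / 2) ≤ Real.sin (ϑ a)) :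
    ϑ b - ϑ a ≤ 10 * (b - a) := by
  have hI' : ∀ R ∈ Ico a b, ϑ R ∈ Ioo (-(π / 2)) (π / 2) := fun R hR => by
    rcases hR.1.eq_or_lt with h1 | h1
    · exact h1 ▸ ha
    · exact hI R ⟨h1, hR.2⟩
  have hsin : ∀ R ∈ Icc a b, -(1 / 2) ≤ Real.sin (ϑ R) := fun R hR =>
    has.trans (Real.sin_le_sin_of_le_of_le_pi_div_two (h.mem a).1 (h.mem R).2
      (hmono (left_mem_Icc.2 hab.le) hR hR.1))
  have hpos : ∀ R ∈ Icc a b, 0 < 1 + Real.sin (ϑ R) := fun R hR => by linarith [hsin R hR]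
  let g : ℝ → ℝ := fun R => -(1 + Real.sin (ϑ R))⁻¹
  let g' : ℝ → ℝ := fun R => Real.cos (ϑ R) * deriv ϑ R / (1 + Real.sin (ϑ R)) ^ 2
  have hg : ∀ R ∈ Ico a b, HasDerivAt g (g' R) R := fun R hR => by
    have h1 := ((h.hasDerivAt (hI' R hR)).sin.const_add 1).inv
      (hpos R (Ico_subset_Icc_self hR)).ne'
    exact h1.neg.congr_deriv (by simp only [g']; ring)
  have hg' : ∀ R ∈ Ico a b, ∃ d ≤ 10, HasDerivAt g' d R := fun R hR => by
    have hθ := h.hasDerivAt (hI' R hR)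
    have hp := hpos R (Ico_subset_Icc_self hR)
    have h1 := (hθ.cos.mul (h.hasDerivAt_deriv (hI' R hR))).div
      ((hθ.sin.const_add 1).pow 2) (pow_ne_zero 2 hp.ne')
    refine ⟨_, ?_, h1⟩
    have hcurv := (abs_le.1 (h.curvature_le R (hI' R hR))).2
    have hcs := Real.sin_sq_add_cos_sq (ϑ R)
    have hs := hsin R (Ico_subset_Icc_self hR)
    simp only [Pi.pow_apply, Pi.mul_apply]
    set s := Real.sin (ϑ R)
    set c := Real.cos (ϑ R)
    set t := deriv ϑ R
    set t' := deriv (deriv ϑ) R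
    have e : ((-s * t * t + c * t') * (1 + s) ^ 2 -
        c * t * ((2 : ℕ) * (1 + s) ^ (2 - 1) * (c * t))) / ((1 + s) ^ 2) ^ 2 =
        (c * t' - s * t ^ 2 - 2 * (1 - s) * t ^ 2) / (1 + s) ^ 2 := by
      have hc2 : c ^ 2 = (1 - s) * (1 + s) := by linear_combination hcs
      rw [div_eq_div_iff (by positivity) (by positivity)]
      push_cast
      linear_combination (-(2 * t ^ 2 * (1 + s) ^ 3)) * hc2
    rw [e, div_le_iff₀ (by positivity)]
    have h2 : c * t' - s * t ^ 2 - 2 * (1 - s) * t ^ 2 ≤ 2 - s := by nlinarith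
    nlinarith
  have hk : AntitoneOn (fun R => g' R - 10 * (R - a)) (Ico a b) := by
    refine antitoneOn_of_deriv_nonpos (convex_Ico a b) (fun R hR => ?_) (fun R hR => ?_)
      fun R hR => ?_
    · obtain ⟨d, -, hd⟩ := hg' R hR
      exact (hd.sub (((hasDerivAt_id R).sub_const a).const_mul 10)).continuousAt.continuousWithinAt
    · rw [interior_Ico] at hR
      obtain ⟨d, -, hd⟩ := hg' R (Ioo_subset_Ico_self hR)
      exact (hd.sub (((hasDerivAt_id R).sub_const a).const_mul
        10)).differentiableAt.differentiableWithinAt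
    · rw [interior_Ico] at hR
      obtain ⟨d, hd10, hd⟩ := hg' R (Ioo_subset_Ico_self hR)
      have := (hd.sub (((hasDerivAt_id R).sub_const a).const_mul 10)).deriv
      refine Eq.trans_le this ?_
      linarith
  have hg'le : ∀ R ∈ Ico a b, g' R ≤ 10 * (R - a) := fun R hR => by
    have := hk (left_mem_Ico.2 hab) hR hR.1
    simp only [g', ha0, mul_zero, zero_div, sub_self] at this
    simp only [g']
    linarith
  have hanti : AntitoneOn (fun R => g R - 5 * (R - a) ^ 2) (Icc a b) := by
    have hd : ∀ R ∈ Ioo a b, HasDerivAt (fun R => g R - 5 * (R - a) ^ 2)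
        (g' R - 10 * (R - a)) R := fun R hR => by
      refine ((hg R (Ioo_subset_Ico_self hR)).sub ((((hasDerivAt_id R).sub_const a).pow
        2).const_mul 5)).congr_deriv ?_
      simp; ring
    refine antitoneOn_of_deriv_nonpos (convex_Icc a b) ?_ (fun R hR => ?_) fun R hR => ?_
    · refine ContinuousOn.sub (ContinuousOn.neg (ContinuousOn.inv₀ ?_ fun R hR =>
        (hpos R hR).ne')) (by fun_prop)
      exact (continuous_const.add (Real.continuous_sin.comp h.cont)).continuousOn
    · rw [interior_Icc] at hR
      exact (hd R hR).differentiableAt.differentiableWithinAt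
    · rw [interior_Icc] at hR
      rw [(hd R hR).deriv]
      linarith [hg'le R (Ioo_subset_Ico_self hR)]
  have hfin := hanti (left_mem_Icc.2 hab.le) (right_mem_Icc.2 hab.le) hab.le
  simp only [g, sub_self] at hfin
  have hpa := hpos a (left_mem_Icc.2 hab.le)
  have hpb := hpos b (right_mem_Icc.2 hab.le)
  have hsb := Real.sin_le_one (ϑ b)
  have hsa := Real.sin_le_one (ϑ a)
  have hσ : Real.sin (ϑ b) - Real.sin (ϑ a) ≤ 20 * (b - a) ^ 2 := by
    have e : (1 + Real.sin (ϑ a))⁻¹ - (1 + Real.sin (ϑ b))⁻¹ =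
        (Real.sin (ϑ b) - Real.sin (ϑ a)) /
          ((1 + Real.sin (ϑ a)) * (1 + Real.sin (ϑ b))) := by field_simp; ring
    have h5 : (Real.sin (ϑ b) - Real.sin (ϑ a)) /
        ((1 + Real.sin (ϑ a)) * (1 + Real.sin (ϑ b))) ≤ 5 * (b - a) ^ 2 := by
      rw [← e]; linarith
    rw [div_le_iff₀ (mul_pos hpa hpb)] at h5
    have h6 : (1 + Real.sin (ϑ a)) * (1 + Real.sin (ϑ b)) ≤ 4 := by nlinarith
    nlinarith [sq_nonneg (b - a)]
  have hle := hmono (left_mem_Icc.2 hab.le) (right_mem_Icc.2 hab.le) hab.le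
  have h7 := sq_sub_le_of_sin_sub_le (h.mem a).1 hle (h.mem b).2
  refine le_of_sq_le_sq ?_ (by linarith)
  nlinarith

/-- A maximal increasing arc either has a bounded mean slope or crosses the middle of the strip. -/
theorem sub_le_or_crosses (h : IsCurvatureBoundedAngle ϑ) {a b : ℝ} (hab : a < b)
    (hI : ∀ R ∈ Ioo a b, ϑ R ∈ Ioo (-(π / 2)) (π / 2)) (hd : ∀ R ∈ Ioo a b, 0 < deriv ϑ R)
    (ha : ϑ a ∈ Ioo (-(π / 2)) (π / 2) → deriv ϑ a = 0)
    (hb : ϑ b ∈ Ioo (-(π / 2)) (π / 2) → deriv ϑ b = 0) :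
    ϑ b - ϑ a ≤ 10 * (b - a) ∨ ϑ a < -(π / 6) ∧ π / 6 < ϑ b := by
  have hpi := Real.pi_pos
  have hstrict : StrictMonoOn ϑ (Icc a b) :=
    strictMonoOn_of_deriv_pos (convex_Icc a b) h.cont.continuousOn fun R hR => by
      rw [interior_Icc] at hR; exact hd R hR
  have hlt := hstrict (left_mem_Icc.2 hab.le) (right_mem_Icc.2 hab.le) hab
  rcases lt_or_ge (ϑ a) (-(π / 6)) with h1 | h1
  · rcases lt_or_ge (π / 6) (ϑ b) with h2 | h2
    · exact Or.inr ⟨h1, h2⟩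
    · -- the reflection in the origin exchanges the two ends of the arc
      left
      have hbI : ϑ b ∈ Ioo (-(π / 2)) (π / 2) :=
        ⟨(h.mem a).1.trans_lt hlt, by linarith⟩
      have e : deriv (fun R => -ϑ (-R)) = fun R => deriv ϑ (-R) := by
        funext x
        rw [deriv.fun_neg, deriv_comp_neg ϑ x, neg_neg]
      have := h.comp_neg.neg.sub_le_of_deriv_eq_zero (a := -b) (b := -a) (by linarith)
        (fun x hx y hy hxy => neg_le_neg (hstrict.monotoneOn
          ⟨by linarith [hy.2], by linarith [hy.1]⟩ ⟨by linarith [hx.2], by linarith [hx.1]⟩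
          (by linarith)))
        (fun R hR => by
          have := hI (-R) ⟨by linarith [hR.2], by linarith [hR.1]⟩
          exact ⟨by linarith [this.2], by linarith [this.1]⟩)
        (by
          rw [neg_neg]
          exact ⟨by linarith [hbI.2], by linarith [hbI.1]⟩)
        (by rw [e]; simpa using hb hbI)
        (by
          simp only [neg_neg, Real.sin_neg]
          have := Real.sin_le_sin_of_le_of_le_pi_div_two (h.mem b).1 (by linarith) h2
          rw [Real.sin_pi_div_six] at this
          linarith)
      simp only [neg_neg] at this
      linarith
  · left
    have haI : ϑ a ∈ Ioo (-(π / 2)) (π / 2) := ⟨by linarith, hlt.trans_le (h.mem b).2⟩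
    refine h.sub_le_of_deriv_eq_zero hab hstrict.monotoneOn hI haI (ha haI) ?_
    have := Real.sin_le_sin_of_le_of_le_pi_div_two (by linarith) (h.mem a).2 h1
    rw [Real.sin_neg, Real.sin_pi_div_six] at this
    linarith

end IsCurvatureBoundedAngle

/-! ### Crossings of the middle of the strip -/

/-- A Gronwall estimate: `B' ≥ -3 B` gives `B ≥ B 0 / 8` on `[0, π / 6]`, as `exp (π / 2) ≤ 8`, and
hence a lower bound for the increment of `u`. -/
theorem add_div_le_of_hasDerivAt {u B B' : ℝ → ℝ}
    (hu : ∀ x ∈ Icc 0 (π / 6), HasDerivAt u (B x / Real.cos x ^ 2) x)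
    (hB : ∀ x ∈ Icc 0 (π / 6), HasDerivAt B (B' x) x)
    (hB' : ∀ x ∈ Icc 0 (π / 6), -(3 * B x) ≤ B' x) (hB0 : 0 ≤ B 0) :
    u 0 + B 0 / 16 ≤ u (π / 6) := by
  have hpi := Real.pi_pos
  have hmono : MonotoneOn (fun x => Real.exp (3 * x) * B x) (Icc 0 (π / 6)) := by
    have hd : ∀ x ∈ Icc 0 (π / 6), HasDerivAt (fun x => Real.exp (3 * x) * B x)
        (Real.exp (3 * x) * (3 * B x + B' x)) x := fun x hx => by
      refine ((((hasDerivAt_id x).const_mul 3).exp).mul (hB x hx)).congr_deriv ?_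
      simp; ring
    refine monotoneOn_of_deriv_nonneg (convex_Icc _ _)
      (fun x hx => (hd x hx).continuousAt.continuousWithinAt)
      (fun x hx => (hd x (interior_subset hx)).differentiableAt.differentiableWithinAt)
      fun x hx => ?_
    rw [(hd x (interior_subset hx)).deriv]
    exact mul_nonneg (Real.exp_pos _).le (by linarith [hB' x (interior_subset hx)])
  have hlow : ∀ x ∈ Icc 0 (π / 6), B 0 / 8 ≤ B x := fun x hx => by
    have h1 := hmono (left_mem_Icc.2 (by positivity)) hx hx.1
    simp only [mul_zero, Real.exp_zero, one_mul] at h1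
    have h2 : Real.exp (3 * x) ≤ 8 := by
      have h3 : Real.exp (3 * x) ≤ Real.exp (1 + 1) :=
        Real.exp_le_exp.2 (by linarith [hx.2, Real.pi_lt_four])
      rw [Real.exp_add] at h3
      nlinarith [Real.exp_one_lt_d9, Real.exp_pos 1]
    have h4 : 0 ≤ B x := nonneg_of_mul_nonneg_right (hB0.trans h1) (Real.exp_pos _)
    nlinarith
  have hm2 : MonotoneOn (fun x => u x - B 0 / 8 * x) (Icc 0 (π / 6)) := by
    have hd : ∀ x ∈ Icc 0 (π / 6), HasDerivAt (fun x => u x - B 0 / 8 * x)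
        (B x / Real.cos x ^ 2 - B 0 / 8) x := fun x hx => by
      exact ((hu x hx).sub ((hasDerivAt_id x).const_mul (B 0 / 8))).congr_deriv (by simp)
    refine monotoneOn_of_deriv_nonneg (convex_Icc _ _)
      (fun x hx => (hd x hx).continuousAt.continuousWithinAt)
      (fun x hx => (hd x (interior_subset hx)).differentiableAt.differentiableWithinAt)
      fun x hx => ?_
    have hx' := interior_subset hx
    rw [(hd x hx').deriv, sub_nonneg]
    refine (hlow x hx').trans ?_
    have hc : 0 < Real.cos x := Real.cos_pos_of_mem_Ioo ⟨by linarith [hx'.1], by linarith [hx'.2]⟩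
    rw [le_div_iff₀ (pow_pos hc 2)]
    have h0 : 0 ≤ B x := by linarith [hlow x hx']
    have : Real.cos x ^ 2 ≤ 1 := Real.cos_sq_le_one x
    nlinarith
  have := hm2 (left_mem_Icc.2 (by positivity)) (right_mem_Icc.2 (by positivity)) (by positivity)
  simp only [mul_zero, sub_zero] at this
  have h3 := Real.pi_gt_three
  nlinarith

theorem IsRogers.abs_deriv_angularSlope_le {f : ℂ → ℂ} (hf : IsRogers f) {R α : ℝ}
    (hα : α ∈ Icc (-(π / 6)) (π / 6)) :
    |Real.cos α * ((deriv (deriv (logLift f)) (stripPoint R α)).im -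
        (logLift f (stripPoint R α)).im)| ≤ 3 * angularSlope f (stripPoint R α) := by
  have hpi := Real.pi_pos
  have hα' : α ∈ Ioo (-(π / 2)) (π / 2) := ⟨by linarith [hα.1], by linarith [hα.2]⟩
  obtain ⟨hB, X, Y, hXY, -, hY⟩ := hf.exists_gradient_angularSlope (stripPoint_mem (R := R).2 hα')
  rw [stripPoint_im] at hY
  have hYle : |Y| ≤ 2 * angularSlope f (stripPoint R α) :=
    abs_le_of_sq_le_sq (by nlinarith [sq_nonneg X]) (by linarith)
  have hc : 5 / 6 ≤ Real.cos α := by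
    rw [← Real.cos_abs]
    have h1 := Real.cos_le_cos_of_nonneg_of_le_pi (abs_nonneg α) (by linarith) (abs_le.2 hα)
    rw [Real.cos_pi_div_six] at h1
    have : (5 / 3 : ℝ) ≤ √3 := Real.le_sqrt_of_sq_le (by norm_num)
    linarith
  have hs : |Real.sin α| ≤ 1 / 2 := by
    rw [abs_le]
    have h1 := Real.sin_le_sin_of_le_of_le_pi_div_two (by linarith [hα.1]) (by linarith) hα.2
    have h2 := Real.sin_le_sin_of_le_of_le_pi_div_two (by linarith) (by linarith [hα.2]) hα.1
    rw [Real.sin_neg] at h2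
    rw [Real.sin_pi_div_six] at h1 h2
    exact ⟨h2, h1⟩
  have hle : Real.cos α * |Real.cos α * ((deriv (deriv (logLift f)) (stripPoint R α)).im -
      (logLift f (stripPoint R α)).im)| ≤ 5 / 2 * angularSlope f (stripPoint R α) := by
    have hc0 : 0 < Real.cos α := by linarith
    calc _ = |Y + Real.sin α * angularSlope f (stripPoint R α)| := by
          rw [← hY, ← abs_of_pos hc0, ← abs_mul, abs_of_pos hc0]; ring_nf
      _ ≤ |Y| + |Real.sin α| * angularSlope f (stripPoint R α) := by
          refine (abs_add_le _ _).trans ?_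
          rw [abs_mul, abs_of_nonneg hB]
      _ ≤ _ := by nlinarith
  nlinarith [abs_nonneg (Real.cos α * ((deriv (deriv (logLift f)) (stripPoint R α)).im -
      (logLift f (stripPoint R α)).im))]

namespace IsSpineAngle

variable {f : ℂ → ℂ} {ϑ : ℝ → ℝ}

/-- Where the spine is far from the middle of the strip, `im F` is not small there. -/
theorem angularSlope_le_abs_im (h : IsSpineAngle f ϑ) (hf : IsRogers f) {b : ℝ}
    (hb : π / 6 ≤ |ϑ b|) :
    angularSlope f (stripPoint b 0) / 16 ≤ |(logLift f (stripPoint b 0)).im| := by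
  have hpi := Real.pi_pos
  have hI : ∀ x ∈ Icc 0 (π / 6), x ∈ Ioo (-(π / 2)) (π / 2) := fun x hx =>
    ⟨by linarith [hx.1], by linarith [hx.2]⟩
  have hI' : ∀ x ∈ Icc 0 (π / 6), -x ∈ Ioo (-(π / 2)) (π / 2) := fun x hx =>
    ⟨by linarith [hx.2], by linarith [hx.1]⟩
  have h0 : (0 : ℝ) ∈ Icc 0 (π / 6) := left_mem_Icc.2 (by positivity)
  have h6 : π / 6 ∈ Icc 0 (π / 6) := right_mem_Icc.2 (by positivity)
  have hB0 := (hf.exists_gradient_angularSlope (stripPoint_mem (R := b).2 (hI 0 h0))).1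
  rcases le_abs.1 hb with hb | hb
  · have := add_div_le_of_hasDerivAt
      (fun x hx => hf.hasDerivAt_im_logLift_div_cos (R := b) (hI x hx))
      (fun x hx => hf.hasDerivAt_angularSlope (R := b) (hI x hx))
      (fun x hx => neg_le_neg (abs_le.1 (hf.abs_deriv_angularSlope_le (R := b)
        ⟨by linarith [hx.1], hx.2⟩)).2) hB0
    have hneg : (logLift f (stripPoint b (π / 6))).im / Real.cos (π / 6) ≤ 0 := by
      refine div_nonpos_of_nonpos_of_nonneg ?_ (Real.cos_pos_of_mem_Ioo (hI _ h6)).le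
      by_contra hpos
      exact hb.not_gt ((h.im_pos_iff (hI _ h6)).1 (not_le.1 hpos))
    rw [Real.cos_zero, div_one] at this
    exact le_abs.2 (Or.inr (by linarith))
  · have hu : ∀ x ∈ Icc 0 (π / 6), HasDerivAt
        (fun x => -((logLift f (stripPoint b (-x))).im / Real.cos (-x)))
        (angularSlope f (stripPoint b (-x)) / Real.cos x ^ 2) x := fun x hx => by
      have := ((hf.hasDerivAt_im_logLift_div_cos (R := b) (hI' x hx)).comp x
        (hasDerivAt_neg x)).neg
      rw [Real.cos_neg] at this
      exact this.congr_deriv (by ring)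
    have hB : ∀ x ∈ Icc 0 (π / 6), HasDerivAt (fun x => angularSlope f (stripPoint b (-x)))
        (Real.cos (-x) * ((deriv (deriv (logLift f)) (stripPoint b (-x))).im -
          (logLift f (stripPoint b (-x))).im)) x := fun x hx =>
      ((hf.hasDerivAt_angularSlope (R := b) (hI' x hx)).comp x
        (hasDerivAt_neg x)).congr_deriv (by ring)
    have := add_div_le_of_hasDerivAt hu hB (fun x hx => (abs_le.1
      (hf.abs_deriv_angularSlope_le (R := b) ⟨by linarith [hx.2], by linarith [hx.1]⟩)).1)
      (by rw [neg_zero]; exact hB0)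
    have hpos : 0 ≤ (logLift f (stripPoint b (-(π / 6)))).im / Real.cos (-(π / 6)) := by
      refine div_nonneg ?_ (Real.cos_pos_of_mem_Ioo (hI' _ h6)).le
      by_contra hneg
      have := (h.im_neg_iff (hI' _ h6)).1 (not_le.1 hneg)
      linarith
    simp only [neg_zero, Real.cos_zero, div_one] at this
    exact le_abs.2 (Or.inl (by linarith))

/-- Between two close zeros the angle stays in the middle of the strip. On the line `α = 0`, the
function `p = im F` satisfies `|p'' - p| ≤ 2 B`, and hence it is small compared with `B` between
two close zeros. -/
theorem abs_lt_of_zeros (h : IsSpineAngle f ϑ) (hf : IsRogers f)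
    (hB : ∀ w ∈ logStrip, 0 < angularSlope f w) {z₁ z₂ b : ℝ} (h1 : ϑ z₁ = 0) (h2 : ϑ z₂ = 0)
    (hb : b ∈ Ioo z₁ z₂) (hz : z₂ - z₁ ≤ 1 / 10) : |ϑ b| < π / 6 := by
  by_contra hcon
  have hpi := Real.pi_pos
  have hz0 : (0 : ℝ) ∈ Ioo (-(π / 2)) (π / 2) := ⟨by linarith, by linarith⟩
  have hlow := h.angularSlope_le_abs_im hf (not_lt.1 hcon)
  set p : ℝ → ℝ := fun x => (logLift f (stripPoint x 0)).im with hp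
  set p' : ℝ → ℝ := fun x => (deriv (logLift f) (stripPoint x 0)).im with hp'
  set p'' : ℝ → ℝ := fun x => (deriv (deriv (logLift f)) (stripPoint x 0)).im
  set K : ℝ → ℝ := fun x => angularSlope f (stripPoint x 0) with hK
  set K' : ℝ → ℝ := fun x => (deriv (deriv (logLift f)) (stripPoint x 0)).re
  have hγ : ∀ x : ℝ, HasDerivAt (fun x => stripPoint x 0) 1 x := fun x => by
    simpa using hasDerivAt_stripPoint (hasDerivAt_const x (0 : ℝ))
  have hdp : ∀ x, HasDerivAt p (p' x) x := fun x => by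
    simpa using (HasDerivAt.comp_ofReal_curve (γ := fun x => stripPoint x 0)
      (hf.hasDerivAt_logLift (stripPoint_mem.2 hz0)) (hγ x)).complex_im
  have hdp' : ∀ x, HasDerivAt p' (p'' x) x := fun x => by
    simpa using (HasDerivAt.comp_ofReal_curve (γ := fun x => stripPoint x 0)
      (hf.hasDerivAt_deriv_logLift (stripPoint_mem.2 hz0)) (hγ x)).complex_im
  have eK : K = fun x => (deriv (logLift f) (stripPoint x 0)).re := by
    funext x; simp [hK, angularSlope]
  have hdK : ∀ x, HasDerivAt K (K' x) x := fun x => by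
    rw [eK]
    simpa using (HasDerivAt.comp_ofReal_curve (γ := fun x => stripPoint x 0)
      (hf.hasDerivAt_deriv_logLift (stripPoint_mem.2 hz0)) (hγ x)).complex_re
  have hKpos : ∀ x, 0 < K x := fun x => hB _ (stripPoint_mem.2 hz0)
  have hgrad : ∀ x, |p'' x - p x| ≤ 2 * K x ∧ |K' x| ≤ 2 * K x := fun x => by
    obtain ⟨-, X, Y, hXY, hX, hY⟩ := hf.exists_gradient_angularSlope
      (stripPoint_mem (R := x).2 hz0)
    simp only [stripPoint_im, Real.cos_zero, Real.sin_zero, one_mul, zero_mul, add_zero,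
      one_pow] at hX hY
    have := hKpos x
    constructor
    · exact abs_le_of_sq_le_sq (by simp only [p'', p, hY]; nlinarith [sq_nonneg X]) (by linarith)
    · exact abs_le_of_sq_le_sq (by simp only [K', hX]; nlinarith [sq_nonneg Y]) (by linarith)
  have hexp : Real.exp (1 / 5) ≤ 5 / 4 := by
    have := Real.exp_bound_div_one_sub_of_interval (x := 1 / 5) (by norm_num) (by norm_num)
    norm_num at this ⊢
    exact this
  have hKle : ∀ x ∈ Icc z₁ z₂, K x ≤ 5 / 4 * K b := by
    intro x hx
    have hd1 : ∀ x, HasDerivAt (fun x => Real.exp (2 * x) * K x)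
        (Real.exp (2 * x) * (2 * K x + K' x)) x := fun x => by
      refine ((((hasDerivAt_id x).const_mul 2).exp).mul (hdK x)).congr_deriv ?_
      simp; ring
    have hd2 : ∀ x, HasDerivAt (fun x => Real.exp (-2 * x) * K x)
        (Real.exp (-2 * x) * (-2 * K x + K' x)) x := fun x => by
      refine ((((hasDerivAt_id x).const_mul (-2)).exp).mul (hdK x)).congr_deriv ?_
      simp; ring
    rcases le_total x b with hxb | hxb
    · have hm := monotone_of_deriv_nonneg (fun x => (hd1 x).differentiableAt) (fun x => by
        rw [(hd1 x).deriv]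
        exact mul_nonneg (Real.exp_pos _).le (by linarith [(abs_le.1 (hgrad x).2).1])) hxb
      have e : Real.exp (2 * b) = Real.exp (2 * x) * Real.exp (2 * (b - x)) := by
        rw [← Real.exp_add]; ring_nf
      simp only [e, mul_assoc] at hm
      have hm' := le_of_mul_le_mul_left hm (Real.exp_pos _)
      have : Real.exp (2 * (b - x)) ≤ 5 / 4 := (Real.exp_le_exp.2 (by
        linarith [hx.1, hb.2])).trans hexp
      nlinarith [hKpos b]
    · have hm := antitone_of_deriv_nonpos (fun x => (hd2 x).differentiableAt) (fun x => by
        rw [(hd2 x).deriv]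
        exact mul_nonpos_of_nonneg_of_nonpos (Real.exp_pos _).le
          (by linarith [(abs_le.1 (hgrad x).2).2])) hxb
      have e : Real.exp (-2 * b) = Real.exp (-2 * x) * Real.exp (2 * (x - b)) := by
        rw [← Real.exp_add]; ring_nf
      simp only [e, mul_assoc] at hm
      have hm' := le_of_mul_le_mul_left hm (Real.exp_pos _)
      have : Real.exp (2 * (x - b)) ≤ 5 / 4 := (Real.exp_le_exp.2 (by
        linarith [hx.2, hb.1])).trans hexp
      nlinarith [hKpos b]
  have hz12 : z₁ < z₂ := hb.1.trans hb.2
  have hp1 : p z₁ = 0 := (h.im_eq_zero_iff hz0).2 h1.symm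
  have hp2 : p z₂ = 0 := (h.im_eq_zero_iff hz0).2 h2.symm
  obtain ⟨y, hy, hmax⟩ := isCompact_Icc.exists_isMaxOn (nonempty_Icc.2 hz12.le)
    (f := fun x => |p x|) (fun x _ => (hdp x).continuousAt.abs.continuousWithinAt)
  set M := |p y|
  have hM : ∀ x ∈ Icc z₁ z₂, |p x| ≤ M := fun x hx => hmax hx
  have hp''le : ∀ x ∈ Icc z₁ z₂, ‖p'' x‖ ≤ M + 5 / 2 * K b := fun x hx => by
    rw [Real.norm_eq_abs]
    have := abs_add_le (p'' x - p x) (p x)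
    rw [sub_add_cancel] at this
    linarith [(hgrad x).1, hM x hx, hKle x hx]
  have hM0 : 0 ≤ M := abs_nonneg _
  have hKb := hKpos b
  obtain ⟨c, hc, hc0⟩ := exists_hasDerivAt_eq_zero hz12
    (fun x _ => (hdp x).continuousAt.continuousWithinAt) (hp1.trans hp2.symm) (fun x _ => hdp x)
  have hp'le : ∀ x ∈ Icc z₁ z₂, ‖p' x‖ ≤ (M + 5 / 2 * K b) * (1 / 10) := fun x hx => by
    have := (convex_Icc z₁ z₂).norm_image_sub_le_of_norm_hasDerivWithin_le
      (fun x _ => (hdp' x).hasDerivWithinAt) hp''le (Ioo_subset_Icc_self hc) hx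
    rw [hc0, sub_zero] at this
    refine this.trans (mul_le_mul_of_nonneg_left ?_ (by linarith))
    rw [Real.norm_eq_abs, abs_le]
    constructor <;> linarith [hx.1, hx.2, hc.1, hc.2]
  have hMle : M ≤ (M + 5 / 2 * K b) * (1 / 10) * (1 / 10) := by
    have := (convex_Icc z₁ z₂).norm_image_sub_le_of_norm_hasDerivWithin_le
      (fun x _ => (hdp x).hasDerivWithinAt) hp'le (left_mem_Icc.2 hz12.le) hy
    rw [hp1, sub_zero] at this
    refine this.trans (mul_le_mul_of_nonneg_left ?_ (by positivity))
    rw [Real.norm_eq_abs, abs_le]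
    constructor <;> linarith [hy.1, hy.2]
  have := hM b (Ioo_subset_Icc_self hb)
  have hlow' : K b / 16 ≤ |p b| := hlow
  linarith

end IsSpineAngle

/-! ### Components of open subsets of the line -/

theorem sInf_connectedComponentIn_notMem {G : Set ℝ} (hG : IsOpen G) {x : ℝ} (hx : x ∈ G)
    (hb : BddBelow (connectedComponentIn G x)) : sInf (connectedComponentIn G x) ∉ G := by
  intro ha
  set J := connectedComponentIn G x
  set a := sInf J
  have hxJ : x ∈ J := mem_connectedComponentIn hx
  obtain ⟨ε, hε, hball⟩ := Metric.isOpen_iff.1 hG a ha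
  rw [Real.ball_eq_Ioo] at hball
  obtain ⟨y, hyJ, hy⟩ := exists_lt_of_csInf_lt ⟨x, hxJ⟩ (show a < a + ε by linarith)
  have hay : a ≤ y := csInf_le hb hyJ
  have hU : IsPreconnected (J ∪ Ioo (a - ε) (a + ε)) :=
    IsPreconnected.union y hyJ ⟨by linarith, hy⟩ isPreconnected_connectedComponentIn
      isPreconnected_Ioo
  have hsub := hU.subset_connectedComponentIn (F := G) (Or.inl hxJ)
    (union_subset (connectedComponentIn_subset G x) hball)
  have : a ≤ a - ε / 2 := csInf_le hb (hsub (Or.inr ⟨by linarith, by linarith⟩))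
  linarith

theorem sSup_connectedComponentIn_notMem {G : Set ℝ} (hG : IsOpen G) {x : ℝ} (hx : x ∈ G)
    (hb : BddAbove (connectedComponentIn G x)) : sSup (connectedComponentIn G x) ∉ G := by
  intro ha
  set J := connectedComponentIn G x
  set a := sSup J
  have hxJ : x ∈ J := mem_connectedComponentIn hx
  obtain ⟨ε, hε, hball⟩ := Metric.isOpen_iff.1 hG a ha
  rw [Real.ball_eq_Ioo] at hball
  obtain ⟨y, hyJ, hy⟩ := exists_lt_of_lt_csSup ⟨x, hxJ⟩ (show a - ε < a by linarith)
  have hay : y ≤ a := le_csSup hb hyJ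
  have hU : IsPreconnected (J ∪ Ioo (a - ε) (a + ε)) :=
    IsPreconnected.union y hyJ ⟨hy, by linarith⟩ isPreconnected_connectedComponentIn
      isPreconnected_Ioo
  have hsub := hU.subset_connectedComponentIn (F := G) (Or.inl hxJ)
    (union_subset (connectedComponentIn_subset G x) hball)
  have : a + ε / 2 ≤ a := le_csSup hb (hsub (Or.inr ⟨by linarith, by linarith⟩))
  linarith

theorem exists_connectedComponentIn_eq_Ioo {G : Set ℝ} (hG : IsOpen G) {x : ℝ} (hx : x ∈ G)
    (h1 : BddBelow (connectedComponentIn G x)) (h2 : BddAbove (connectedComponentIn G x)) :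
    ∃ a b, a < b ∧ connectedComponentIn G x = Ioo a b ∧ a ∉ G ∧ b ∉ G := by
  have ha := sInf_connectedComponentIn_notMem hG hx h1
  have hb := sSup_connectedComponentIn_notMem hG hx h2
  set J := connectedComponentIn G x with hJ
  have hxJ : x ∈ J := mem_connectedComponentIn hx
  have hsub : J ⊆ G := connectedComponentIn_subset G x
  have hJc : IsConnected J := ⟨⟨x, hxJ⟩, isPreconnected_connectedComponentIn⟩
  have hlow : ∀ y ∈ J, sInf J < y := fun y hy =>
    lt_of_le_of_ne (csInf_le h1 hy) fun e => ha (e ▸ hsub hy)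
  have hhigh : ∀ y ∈ J, y < sSup J := fun y hy =>
    lt_of_le_of_ne (le_csSup h2 hy) fun e => hb (e ▸ hsub hy)
  exact ⟨sInf J, sSup J, (hlow x hxJ).trans (hhigh x hxJ),
    Subset.antisymm (fun y hy => ⟨hlow y hy, hhigh y hy⟩) (hJc.Ioo_csInf_csSup_subset h1 h2),
    ha, hb⟩

theorem exists_connectedComponentIn_eq_Ioi {G : Set ℝ} (hG : IsOpen G) {x : ℝ} (hx : x ∈ G)
    (h1 : BddBelow (connectedComponentIn G x)) (h2 : ¬BddAbove (connectedComponentIn G x)) :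
    ∃ a, connectedComponentIn G x = Ioi a ∧ a ∉ G := by
  have ha := sInf_connectedComponentIn_notMem hG hx h1
  set J := connectedComponentIn G x with hJ
  have hxJ : x ∈ J := mem_connectedComponentIn hx
  have hsub : J ⊆ G := connectedComponentIn_subset G x
  refine ⟨sInf J, Subset.antisymm (fun y hy =>
    lt_of_le_of_ne (csInf_le h1 hy) fun e => ha (e ▸ hsub hy)) fun y hy => ?_, ha⟩
  obtain ⟨u, huJ, hu⟩ := exists_lt_of_csInf_lt ⟨x, hxJ⟩ hy
  obtain ⟨v, hvJ, hv⟩ := not_bddAbove_iff.1 h2 y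
  exact isPreconnected_connectedComponentIn.ordConnected.out huJ hvJ ⟨hu.le, hv.le⟩

theorem disjoint_of_components {α : Type*} [TopologicalSpace α] {G J₁ J₂ : Set α}
    (h1 : ∃ x ∈ G, J₁ = connectedComponentIn G x) (h2 : ∃ x ∈ G, J₂ = connectedComponentIn G x)
    (hne : J₁ ≠ J₂) : Disjoint J₁ J₂ := by
  obtain ⟨x, -, rfl⟩ := h1
  obtain ⟨y, -, rfl⟩ := h2
  by_contra h
  rw [not_disjoint_iff] at h
  obtain ⟨z, hz1, hz2⟩ := h
  exact hne ((connectedComponentIn_eq hz1).trans (connectedComponentIn_eq hz2).symm)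

/-! ### Total variation -/

theorem setLIntegral_enorm_deriv_le {φ : ℝ → ℝ} {a b : ℝ} (hab : a ≤ b)
    (hc : ContinuousOn φ (Icc a b)) (hd : ∀ x ∈ Ioo a b, HasDerivAt φ (deriv φ x) x)
    (hpos : ∀ x ∈ Ioo a b, 0 ≤ deriv φ x) :
    ∫⁻ x in Ioo a b, ‖deriv φ x‖ₑ ≤ ENNReal.ofReal (φ b - φ a) := by
  have hint := intervalIntegral.integrableOn_deriv_of_nonneg hc hd hpos
  have h1 := intervalIntegral.integral_eq_sub_of_hasDerivAt_of_le hab hc hd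
    ((intervalIntegrable_iff_integrableOn_Ioc_of_le hab).2 hint)
  rw [intervalIntegral.integral_of_le hab, integral_Ioc_eq_integral_Ioo] at h1
  rw [← h1, ofReal_integral_eq_lintegral_ofReal (hint.mono_set Ioo_subset_Ioc_self)
    ((ae_restrict_iff' measurableSet_Ioo).2 (Eventually.of_forall hpos))]
  refine setLIntegral_mono' measurableSet_Ioo fun x hx => ?_
  rw [Real.enorm_eq_ofReal (hpos x hx)]

theorem eVariationOn_le_setLIntegral_enorm_deriv {φ : ℝ → ℝ} {J : Set ℝ} (hJ : J.OrdConnected)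
    (hd : ∀ x ∈ J, HasDerivAt φ (deriv φ x) x) (hc : ContinuousOn (deriv φ) J) :
    eVariationOn φ J ≤ ∫⁻ x in J, ‖deriv φ x‖ₑ := by
  refine iSup_le fun p => ?_
  obtain ⟨n, u, hu, huJ⟩ := p
  have hstep : ∀ i, edist (φ (u (i + 1))) (φ (u i)) ≤
      ∫⁻ x in Ioc (u i) (u (i + 1)), ‖deriv φ x‖ₑ := fun i => by
    have hle := hu (Nat.le_succ i)
    have hsub : uIcc (u i) (u (i + 1)) ⊆ J := by
      rw [uIcc_of_le hle]; exact hJ.out (huJ _) (huJ _)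
    have h1 := intervalIntegral.integral_eq_sub_of_hasDerivAt (fun x hx => hd x (hsub hx))
      ((hc.mono hsub).intervalIntegrable)
    rw [edist_eq_enorm_sub, ← h1, intervalIntegral.integral_of_le hle]
    exact enorm_integral_le_lintegral_enorm _
  calc ∑ i ∈ Finset.range n, edist (φ (u (i + 1))) (φ (u i))
      ≤ ∑ i ∈ Finset.range n, ∫⁻ x in Ioc (u i) (u (i + 1)), ‖deriv φ x‖ₑ :=
        Finset.sum_le_sum fun i _ => hstep i
    _ = ∫⁻ x in ⋃ i ∈ Finset.range n, Ioc (u i) (u (i + 1)), ‖deriv φ x‖ₑ := by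
        exact (lintegral_biUnion_finset (t := fun i => Ioc (u i) (u (i + 1)))
          (fun i _ j _ hij => hu.pairwise_disjoint_on_Ioc_succ hij)
          (fun _ _ => measurableSet_Ioc) _).symm
    _ ≤ _ := lintegral_mono_set (iUnion₂_subset fun i _ =>
        Ioc_subset_Icc_self.trans (hJ.out (huJ _) (huJ _)))

theorem tsum_indicator_le_of_subsingleton {ι : Type*} {S : Set ι} (hS : S.Subsingleton)
    (c : ℝ≥0∞) : ∑' i, S.indicator (fun _ => c) i ≤ c := by
  rcases S.eq_empty_or_nonempty with rfl | ⟨i, hi⟩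
  · simp
  · rw [tsum_eq_single i fun j hj => indicator_of_notMem (fun h => hj (hS h hi)) _,
      indicator_of_mem hi]

namespace IsCurvatureBoundedAngle

variable {ϑ : ℝ → ℝ}

theorem isOpen_setOf_mem (h : IsCurvatureBoundedAngle ϑ) :
    IsOpen {R | ϑ R ∈ Ioo (-(π / 2)) (π / 2)} := isOpen_Ioo.preimage h.cont

theorem continuousAt_deriv (h : IsCurvatureBoundedAngle ϑ) {R : ℝ}
    (hR : ϑ R ∈ Ioo (-(π / 2)) (π / 2)) : ContinuousAt (deriv ϑ) R :=
  (h.hasDerivAt_deriv hR).continuousAt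

/-- The variation of the angle along a maximal monotone arc. -/
theorem setLIntegral_le_or_crosses (h : IsCurvatureBoundedAngle ϑ) {a b : ℝ} (hab : a < b)
    (hI : ∀ R ∈ Ioo a b, ϑ R ∈ Ioo (-(π / 2)) (π / 2)) (hd : ∀ R ∈ Ioo a b, deriv ϑ R ≠ 0) :
    ∫⁻ x in Ioo a b, ‖deriv ϑ x‖ₑ ≤ ENNReal.ofReal π ∧
    ((ϑ a ∈ Ioo (-(π / 2)) (π / 2) → deriv ϑ a = 0) →
      (ϑ b ∈ Ioo (-(π / 2)) (π / 2) → deriv ϑ b = 0) →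
      ∫⁻ x in Ioo a b, ‖deriv ϑ x‖ₑ ≤ ENNReal.ofReal (10 * (b - a)) ∨
      (π / 6 < |ϑ b| ∧ ∃ z ∈ Ioo a b, ϑ z = 0)) := by
  have hpi := Real.pi_pos
  have hsign : (∀ x ∈ Ioo a b, 0 < deriv ϑ x) ∨ ∀ x ∈ Ioo a b, deriv ϑ x < 0 := by
    have hcont : ContinuousOn (deriv ϑ) (Ioo a b) := fun x hx =>
      (h.continuousAt_deriv (hI x hx)).continuousWithinAt
    by_contra hcon
    push Not at hcon
    obtain ⟨⟨x, hx, hx0⟩, y, hy, hy0⟩ := hcon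
    obtain ⟨z, hz, hz0⟩ := isPreconnected_Ioo.intermediate_value hx hy hcont ⟨hx0, hy0⟩
    exact hd z hz hz0
  wlog hpos : ∀ x ∈ Ioo a b, 0 < deriv ϑ x generalizing ϑ
  · have hneg := hsign.resolve_left hpos
    have e : deriv (fun R => -ϑ R) = fun R => -deriv ϑ R := by funext x; exact deriv.fun_neg
    have hI2 : ∀ R, ϑ R ∈ Ioo (-(π / 2)) (π / 2) ↔ -ϑ R ∈ Ioo (-(π / 2)) (π / 2) := fun R =>
      ⟨fun hR => ⟨by linarith [hR.2], by linarith [hR.1]⟩,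
        fun hR => ⟨by linarith [hR.2], by linarith [hR.1]⟩⟩
    have := this h.neg (fun R hR => (hI2 R).1 (hI R hR))
      (fun R hR => by rw [e]; exact neg_ne_zero.2 (hd R hR))
      (Or.inl fun R hR => by rw [e]; exact neg_pos.2 (hneg R hR))
      (fun R hR => by rw [e]; exact neg_pos.2 (hneg R hR))
    simpa only [e, enorm_neg, ← hI2, neg_eq_zero, abs_neg] using this
  have hle := setLIntegral_enorm_deriv_le hab.le h.cont.continuousOn
    (fun x hx => h.hasDerivAt (hI x hx)) fun x hx => (hpos x hx).le
  refine ⟨hle.trans (ENNReal.ofReal_le_ofReal (by linarith [(h.mem b).2, (h.mem a).1])),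
    fun ha hb => ?_⟩
  rcases h.sub_le_or_crosses hab hI hpos ha hb with h1 | ⟨h1, h2⟩
  · exact Or.inl (hle.trans (ENNReal.ofReal_le_ofReal h1))
  · right
    refine ⟨h2.trans_le (le_abs_self _), ?_⟩
    obtain ⟨z, hz, hz0⟩ := intermediate_value_Ioo hab.le h.cont.continuousOn
      (show (0 : ℝ) ∈ Ioo (ϑ a) (ϑ b) from ⟨by linarith, by linarith⟩)
    exact ⟨z, hz, hz0⟩

/-- The total variation of the angle over an interval of length at most `1`. The maximal monotone
arcs that do not have a bounded mean slope are the two arcs at the ends of the interval and those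
that cross the middle of the strip; there is at most one crossing in each of the ten parts of the
interval of length `1 / 10`. -/
theorem setLIntegral_enorm_deriv_le (h : IsCurvatureBoundedAngle ϑ)
    (hcross : ∀ z₁ z₂ b, ϑ z₁ = 0 → ϑ z₂ = 0 → b ∈ Ioo z₁ z₂ → z₂ - z₁ ≤ 1 / 10 →
      |ϑ b| < π / 6) {A B : ℝ} (hAB : A ≤ B) (hBA : B ≤ A + 1) :
    ∫⁻ x in {x | x ∈ Icc A B ∧ ϑ x ∈ Ioo (-(π / 2)) (π / 2)}, ‖deriv ϑ x‖ₑ ≤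
      ENNReal.ofReal (10 * (B - A) + 12 * π) := by
  have hpi := Real.pi_pos
  set Z : Set ℝ := {R | ϑ R ∈ Ioo (-(π / 2)) (π / 2)} with hZdef
  have hZ : IsOpen Z := h.isOpen_setOf_mem
  set G : Set ℝ := {x | x ∈ Ioo A B ∧ x ∈ Z ∧ deriv ϑ x ≠ 0} with hGdef
  have hG : IsOpen G := by
    rw [isOpen_iff_mem_nhds]
    rintro x ⟨h1, h2, h3⟩
    filter_upwards [isOpen_Ioo.mem_nhds h1, hZ.mem_nhds h2,
      (h.continuousAt_deriv h2).eventually_ne h3] with y hy1 hy2 hy3 using ⟨hy1, hy2, hy3⟩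
  -- the critical points and the ends of the interval do not contribute
  have hred : ∫⁻ x in {x | x ∈ Icc A B ∧ x ∈ Z}, ‖deriv ϑ x‖ₑ ≤ ∫⁻ x in G, ‖deriv ϑ x‖ₑ := by
    have hsub : {x | x ∈ Icc A B ∧ x ∈ Z} ⊆ (G ∪ {x | x ∈ Z ∧ deriv ϑ x = 0}) ∪ {A, B} := by
      rintro x ⟨h1, h2⟩
      rcases eq_endpoints_or_mem_Ioo_of_mem_Icc h1 with e | e | e
      · exact Or.inr (Or.inl e)
      · exact Or.inr (Or.inr e)
      · by_cases h0 : deriv ϑ x = 0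
        · exact Or.inl (Or.inr ⟨h2, h0⟩)
        · exact Or.inl (Or.inl ⟨e, h2, h0⟩)
    have hmeas : MeasurableSet {x | x ∈ Z ∧ deriv ϑ x = 0} :=
      hZ.measurableSet.inter (measurable_deriv ϑ (measurableSet_singleton 0))
    have h0 : ∫⁻ x in {x | x ∈ Z ∧ deriv ϑ x = 0}, ‖deriv ϑ x‖ₑ = 0 := by
      rw [setLIntegral_congr_fun (g := fun _ => 0) hmeas fun x hx => by simp [hx.2]]
      simp
    have h1 : ∫⁻ x in ({A, B} : Set ℝ), ‖deriv ϑ x‖ₑ = 0 :=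
      setLIntegral_measure_zero _ _ ((Set.toFinite {A, B}).measure_zero _)
    calc _ ≤ _ := lintegral_mono_set hsub
      _ ≤ _ := lintegral_union_le _ _ _
      _ ≤ _ := add_le_add_left (lintegral_union_le _ _ _) _
      _ = _ := by rw [h0, h1, add_zero, add_zero]
  refine hred.trans ?_
  let 𝒥 : Set (Set ℝ) := {J | ∃ x ∈ G, J = connectedComponentIn G x}
  have hIoo : ∀ J ∈ 𝒥, ∃ a b, a < b ∧ J = Ioo a b ∧ J ⊆ G ∧ a ∉ G ∧ b ∉ G := by
    rintro J ⟨x, hx, rfl⟩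
    have hs := connectedComponentIn_subset G x
    obtain ⟨a, b, h1, h2, h3, h4⟩ := exists_connectedComponentIn_eq_Ioo hG hx
      ⟨A, fun y hy => (hs hy).1.1.le⟩ ⟨B, fun y hy => (hs hy).1.2.le⟩
    exact ⟨a, b, h1, h2, hs, h3, h4⟩
  have hdisj : 𝒥.PairwiseDisjoint id := fun J₁ h1 J₂ h2 hne => disjoint_of_components h1 h2 hne
  have hopen : ∀ J ∈ 𝒥, IsOpen J := fun J hJ => by
    obtain ⟨a, b, -, e, -⟩ := hIoo J hJ
    rw [e]; exact isOpen_Ioo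
  have hcount : 𝒥.Countable := hdisj.countable_of_isOpen hopen fun J hJ => by
    obtain ⟨a, b, hab, e, -⟩ := hIoo J hJ
    rw [id, e]; exact nonempty_Ioo.2 hab
  have hcover : G = ⋃ J ∈ 𝒥, J := Subset.antisymm
    (fun x hx => mem_iUnion₂.2 ⟨_, ⟨x, hx, rfl⟩, mem_connectedComponentIn hx⟩)
    (iUnion₂_subset fun J hJ => (hIoo J hJ).choose_spec.choose_spec.2.2.1)
  have hsplit : ∫⁻ x in G, ‖deriv ϑ x‖ₑ = ∑' J : 𝒥, ∫⁻ x in (J : Set ℝ), ‖deriv ϑ x‖ₑ := by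
    conv_lhs => rw [hcover]
    exact lintegral_biUnion hcount (fun J hJ => (hopen J hJ).measurableSet) hdisj _
  have hvol : ∑' J : 𝒥, volume (J : Set ℝ) ≤ ENNReal.ofReal (B - A) := by
    have e := measure_biUnion (μ := volume) hcount hdisj fun J hJ => (hopen J hJ).measurableSet
    simp only [id] at e
    rw [← e, ← hcover, ← Real.volume_Ioo]
    exact measure_mono fun x hx => hx.1
  -- the classes of exceptional arcs
  let C : ℕ → Set 𝒥 := fun k => {J | ∃ a b z, (J : Set ℝ) = Ioo a b ∧ π / 6 < |ϑ b| ∧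
    z ∈ Ioo a b ∧ ϑ z = 0 ∧ A + k / 10 ≤ z ∧ z ≤ A + (k + 1) / 10}
  let S : Fin 12 → Set 𝒥 := fun k => if k = 10 then {J | ∃ b > A, (J : Set ℝ) = Ioo A b}
    else if k = 11 then {J | ∃ a < B, (J : Set ℝ) = Ioo a B} else C k
  have hinter : ∀ J₁ J₂ : 𝒥, ((J₁ : Set ℝ) ∩ J₂).Nonempty → J₁ = J₂ := fun J₁ J₂ hne => by
    by_contra hJ
    exact (hdisj J₁.2 J₂.2 fun e => hJ (Subtype.ext e)).ne_of_mem hne.some_mem.1 hne.some_mem.2 rfl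
  have hC' : ∀ (J₁ J₂ : 𝒥) (a₁ b₁ z₁ a₂ b₂ z₂ : ℝ), (J₁ : Set ℝ) = Ioo a₁ b₁ →
      (J₂ : Set ℝ) = Ioo a₂ b₂ → π / 6 < |ϑ b₁| → z₁ ∈ Ioo a₁ b₁ → z₂ ∈ Ioo a₂ b₂ → ϑ z₁ = 0 →
      ϑ z₂ = 0 → z₁ ≤ z₂ → z₂ - z₁ ≤ 1 / 10 → J₁ = J₂ := by
    intro J₁ J₂ a₁ b₁ z₁ a₂ b₂ z₂ e₁ e₂ hb₁ hz₁ hz₂ h01 h02 hle hz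
    apply hinter
    by_contra hne
    rw [not_nonempty_iff_eq_empty] at hne
    have hbz : b₁ < z₂ := by
      refine lt_of_le_of_ne (not_lt.1 fun hlt => ?_) fun e => ?_
      · have : z₂ ∈ (J₁ : Set ℝ) ∩ J₂ := by
          rw [e₁, e₂]; exact ⟨⟨hz₁.1.trans_le hle, hlt⟩, hz₂⟩
        rw [hne] at this
        exact this
      · rw [e, h02, abs_zero] at hb₁; linarith
    exact (hcross z₁ z₂ b₁ h01 h02 ⟨hz₁.2, hbz⟩ hz).not_gt hb₁
  have hC : ∀ k, (C k).Subsingleton := by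
    rintro k J₁ ⟨a₁, b₁, z₁, e₁, hb₁, hz₁, h01, hl₁, hu₁⟩ J₂
      ⟨a₂, b₂, z₂, e₂, hb₂, hz₂, h02, hl₂, hu₂⟩
    rcases le_total z₁ z₂ with hle | hle
    · exact hC' J₁ J₂ a₁ b₁ z₁ a₂ b₂ z₂ e₁ e₂ hb₁ hz₁ hz₂ h01 h02 hle (by linarith)
    · exact (hC' J₂ J₁ a₂ b₂ z₂ a₁ b₁ z₁ e₂ e₁ hb₂ hz₂ hz₁ h02 h01 hle (by linarith)).symm
  have hS : ∀ k, (S k).Subsingleton := by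
    intro k
    simp only [S]
    split_ifs
    · rintro J₁ ⟨b₁, h1, e₁⟩ J₂ ⟨b₂, h2, e₂⟩
      apply hinter
      rw [e₁, e₂, Ioo_inter_Ioo]
      exact nonempty_Ioo.2 (by simp [h1.lt, h2.lt])
    · rintro J₁ ⟨a₁, h1, e₁⟩ J₂ ⟨a₂, h2, e₂⟩
      apply hinter
      rw [e₁, e₂, Ioo_inter_Ioo]
      exact nonempty_Ioo.2 (by simp [h1, h2])
    · exact hC k
  have hbound : ∀ J : 𝒥, ∫⁻ x in (J : Set ℝ), ‖deriv ϑ x‖ₑ ≤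
      ENNReal.ofReal 10 * volume (J : Set ℝ) + ∑' k, (S k).indicator (fun _ => ENNReal.ofReal π) J := by
    intro J
    obtain ⟨a, b, hab, e, hJG, haG, hbG⟩ := hIoo J J.2
    have hmem : ∀ x ∈ Ioo a b, x ∈ G := fun x hx => hJG (e ▸ hx)
    have hA : A ≤ a := by
      by_contra hlt
      have := (hmem ((a + min b A) / 2) ⟨by
        have : a < min b A := lt_min hab (not_le.1 hlt)
        linarith, by linarith [min_le_left b A]⟩).1.1
      have h2 := not_le.1 hlt
      have h3 := min_le_right b A
      linarith
    have hB : b ≤ B := by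
      by_contra hlt
      have := (hmem ((b + max a B) / 2) ⟨by linarith [le_max_left a B], by
        have : max a B < b := max_lt hab (not_le.1 hlt)
        linarith⟩).1.2
      have h2 := not_le.1 hlt
      have h3 := le_max_right a B
      linarith
    obtain ⟨hπ, hor⟩ := h.setLIntegral_le_or_crosses hab (fun R hR => (hmem R hR).2.1)
      fun R hR => (hmem R hR).2.2
    have hexc : ∀ k, J ∈ S k → ∫⁻ x in (J : Set ℝ), ‖deriv ϑ x‖ₑ ≤ ENNReal.ofReal 10 *
        volume (J : Set ℝ) + ∑' k, (S k).indicator (fun _ => ENNReal.ofReal π) J := fun k hk => by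
      rw [e]
      refine hπ.trans (le_add_left ?_)
      refine le_trans ?_ (ENNReal.le_tsum k)
      rw [indicator_of_mem hk]
    rcases hA.eq_or_lt with rfl | hA'
    · exact hexc 10 ⟨b, hab, e⟩
    rcases hB.eq_or_lt with rfl | hB'
    · exact hexc 11 ⟨a, hab, e⟩
    rcases hor (fun ha => by_contra fun h0 => haG ⟨⟨hA', hab.trans hB'⟩, ha, h0⟩)
      (fun hb => by_contra fun h0 => hbG ⟨⟨hA'.trans hab, hB'⟩, hb, h0⟩) with
      h1 | ⟨h1, z, hz, hz0⟩
    · rw [e, Real.volume_Ioo, ← ENNReal.ofReal_mul (by norm_num)]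
      exact le_add_right h1
    · have hzA : 0 ≤ 10 * (z - A) := by linarith [hz.1]
      have hk1 := Nat.floor_le hzA
      have hk2 := Nat.lt_floor_add_one (10 * (z - A))
      have hk3 : ⌊10 * (z - A)⌋₊ < 10 := by
        rw [Nat.floor_lt hzA]; push_cast; linarith [hz.2]
      refine hexc ⟨⌊10 * (z - A)⌋₊, by omega⟩ ?_
      have n1 : (⟨⌊10 * (z - A)⌋₊, by omega⟩ : Fin 12) ≠ 10 := fun e => by
        have := congrArg Fin.val e
        simp only [Fin.coe_ofNat_eq_mod] at this
        omega
      have n2 : (⟨⌊10 * (z - A)⌋₊, by omega⟩ : Fin 12) ≠ 11 := fun e => by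
        have := congrArg Fin.val e
        simp only [Fin.coe_ofNat_eq_mod] at this
        omega
      simp only [S, if_neg n1, if_neg n2]
      exact ⟨a, b, z, e, h1, hz, hz0, by linarith, by linarith⟩
  calc ∫⁻ x in G, ‖deriv ϑ x‖ₑ
      ≤ ∑' J : 𝒥, (ENNReal.ofReal 10 * volume (J : Set ℝ) +
        ∑' k, (S k).indicator (fun _ => ENNReal.ofReal π) J) := by
        rw [hsplit]; exact ENNReal.tsum_le_tsum hbound
    _ = ENNReal.ofReal 10 * ∑' J : 𝒥, volume (J : Set ℝ) +
        ∑' k, ∑' J, (S k).indicator (fun _ => ENNReal.ofReal π) J := by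
        rw [ENNReal.tsum_add, ENNReal.tsum_mul_left, ENNReal.tsum_comm]
    _ ≤ ENNReal.ofReal 10 * ENNReal.ofReal (B - A) + ∑' _ : Fin 12, ENNReal.ofReal π :=
        add_le_add (mul_le_mul_right hvol _)
          (ENNReal.tsum_le_tsum fun k => tsum_indicator_le_of_subsingleton (hS k) _)
    _ = ENNReal.ofReal (10 * (B - A) + 12 * π) := by
        have h12 : (12 : ℝ≥0∞) = ENNReal.ofReal 12 := by simp
        rw [tsum_fintype, Finset.sum_const, Finset.card_univ, Fintype.card_fin, nsmul_eq_mul,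
          Nat.cast_ofNat, h12, ← ENNReal.ofReal_mul (by norm_num),
          ← ENNReal.ofReal_mul (by norm_num), ← ENNReal.ofReal_add
          (mul_nonneg (by norm_num) (by linarith)) (by positivity)]

end IsCurvatureBoundedAngle

/-! ### The spine function -/

/-- At a point of the half-plane where a nondegenerate Rogers function is real, it is positive. -/
theorem IsRogers.re_pos_of_im_eq_zero {f : ℂ → ℂ} (hf : IsRogers f)
    (hB : ∀ w ∈ logStrip, 0 < angularSlope f w) {ξ : ℂ} (hξ : ξ ∈ rightHalfPlane)
    (him : (f ξ).im = 0) : 0 < (f ξ).re := by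
  have hξ0 := ne_zero_of_mem_rightHalfPlane hξ
  have hN := Complex.normSq_pos.2 hξ0
  have hx : 0 < ξ.re := hξ
  have h0 := hf.re_nonneg ξ hξ
  rw [Complex.div_re, him, zero_mul, zero_div, add_zero] at h0
  have h1 : 0 ≤ (f ξ).re := by
    by_contra hneg
    have : (f ξ).re * ξ.re / Complex.normSq ξ < 0 :=
      div_neg_of_neg_of_pos (mul_neg_of_neg_of_pos (not_le.1 hneg) hx) hN
    linarith
  refine lt_of_le_of_ne h1 fun e => ?_
  have hfz : f ξ = 0 := Complex.ext e.symm him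
  have hw := log_mem_logStrip hξ
  have hexp : Complex.exp (Complex.log ξ) = ξ := Complex.exp_log hξ0
  have hslope := hf.angularSlope_eq hw
  obtain ⟨hH, hH0, -, -⟩ := derivs_comp_discToHalfPlane hf.differentiableOn_div
    (exp_mem_rightHalfPlane hw)
  have hle := norm_deriv_zero_le_of_re_nonneg hH (hf.re_comp_discToHalfPlane_nonneg hw)
  rw [hH0] at hle
  simp only [hexp, hfz, zero_div, Complex.zero_re, mul_zero, zero_add] at hle hslope
  -- by the Schwarz–Pick inequality a zero of `f` makes the angular slope vanish as well
  have hD := norm_le_zero_iff.1 hle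
  rw [hD] at hslope
  simp only [Complex.zero_re, zero_div, mul_zero] at hslope
  exact (hB _ hw).ne hslope

/-- The curve `r ↦ r exp (i ϑ (log r))`. -/
noncomputable def spineCurve (ϑ : ℝ → ℝ) (r : ℝ) : ℂ :=
  Complex.exp (stripPoint (Real.log r) (ϑ (Real.log r)))

section SpineCurve

variable {ϑ : ℝ → ℝ}

theorem norm_spineCurve {r : ℝ} (hr : 0 < r) : ‖spineCurve ϑ r‖ = r := by
  rw [spineCurve, Complex.norm_exp, stripPoint_re, Real.exp_log hr]

theorem arg_exp_of_mem_Icc {w : ℂ} (hw : w.im ∈ Icc (-(π / 2)) (π / 2)) :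
    (Complex.exp w).arg = w.im := by
  have hpi := Real.pi_pos
  rw [← Complex.log_im, Complex.log_exp (by linarith [hw.1]) (by linarith [hw.2])]

theorem arg_spineCurve (h : ∀ R, ϑ R ∈ Icc (-(π / 2)) (π / 2)) (r : ℝ) :
    (spineCurve ϑ r).arg = ϑ (Real.log r) :=
  arg_exp_of_mem_Icc (h _)

theorem injOn_spineCurve : InjOn (spineCurve ϑ) (Ioi 0) := fun x hx y hy e => by
  rw [← norm_spineCurve (ϑ := ϑ) hx, e, norm_spineCurve hy]

theorem continuousOn_spineCurve (h : Continuous ϑ) : ContinuousOn (spineCurve ϑ) (Ioi 0) := by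
  have hlog : ContinuousOn Real.log (Ioi 0) :=
    Real.continuousOn_log.mono fun x hx => (ne_of_gt hx : x ≠ 0)
  refine Complex.continuous_exp.comp_continuousOn ?_
  simp only [stripPoint_eq]
  exact (Complex.continuous_ofReal.comp_continuousOn hlog).add
    ((Complex.continuous_ofReal.comp_continuousOn (h.comp_continuousOn hlog)).mul
      continuousOn_const)

theorem mem_spineRadii_spineCurve (h : ∀ R, ϑ R ∈ Icc (-(π / 2)) (π / 2)) {r : ℝ} :
    r ∈ spineRadii (spineCurve ϑ) ↔ 0 < r ∧ ϑ (Real.log r) ∈ Ioo (-(π / 2)) (π / 2) := by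
  rw [spineRadii, mem_ofPred_eq, arg_spineCurve h]

theorem isOpen_spineRadii_spineCurve (h : ∀ R, ϑ R ∈ Icc (-(π / 2)) (π / 2))
    (hc : Continuous ϑ) : IsOpen (spineRadii (spineCurve ϑ)) := by
  have e : spineRadii (spineCurve ϑ) =
      Ioi 0 ∩ (fun r => ϑ (Real.log r)) ⁻¹' Ioo (-(π / 2)) (π / 2) := by
    ext r; exact mem_spineRadii_spineCurve h
  rw [e]
  exact (hc.comp_continuousOn (Real.continuousOn_log.mono fun x hx =>
    (ne_of_gt hx : x ≠ 0))).isOpen_inter_preimage isOpen_Ioi isOpen_Ioo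

theorem hasDerivAt_spineCurve {r m : ℝ} (hr : 0 < r) (hm : HasDerivAt ϑ m (Real.log r)) :
    HasDerivAt (spineCurve ϑ) (spineCurve ϑ r * ((r : ℂ)⁻¹ * (1 + m * Complex.I))) r := by
  have h := (hasDerivAt_stripPoint hm).scomp r (Real.hasDerivAt_log hr.ne')
  refine ((Complex.hasDerivAt_exp _).comp_ofReal_curve h).congr_deriv ?_
  simp only [spineCurve, Function.comp_apply, Complex.real_smul, Complex.ofReal_inv]

theorem analyticAt_spineCurve {r : ℝ} (hr : 0 < r) (h : AnalyticAt ℝ ϑ (Real.log r)) :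
    AnalyticAt ℝ (spineCurve ϑ) r := by
  have hlog : AnalyticAt ℝ Real.log r := analyticAt_log hr
  have e : spineCurve ϑ = fun r => Complex.exp (Complex.ofRealCLM (Real.log r) +
      Complex.ofRealCLM (ϑ (Real.log r)) * Complex.I) := by
    funext x; rw [spineCurve, stripPoint_eq]; rfl
  rw [e]
  have h1 : AnalyticAt ℝ (fun r => Complex.ofRealCLM (Real.log r)) r :=
    (Complex.ofRealCLM.analyticAt (Real.log r)).fun_comp hlog
  have h2 : AnalyticAt ℝ (fun r => Complex.ofRealCLM (ϑ (Real.log r))) r :=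
    AnalyticAt.fun_comp (g := Complex.ofRealCLM) (f := fun r => ϑ (Real.log r))
      (Complex.ofRealCLM.analyticAt _) (AnalyticAt.fun_comp h hlog)
  exact (analyticAt_cexp.restrictScalars (𝕜 := ℝ)).fun_comp (h1.add (h2.mul analyticAt_const))

/-! #### The ends of the curves -/

/-- At the end of a component of the set of radii the angle is `± π / 2`, unless the end is `0`,
where the curve tends to the origin. -/
theorem endsAtAxisOrInfinity_of_tendsto (h : ∀ R, ϑ R ∈ Icc (-(π / 2)) (π / 2))
    (hc : Continuous ϑ) {φ : ℝ → ℝ} {l : Filter ℝ} {a : ℝ} (ha : 0 ≤ a)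
    (haZ : a ∉ spineRadii (spineCurve ϑ)) (hφ : Tendsto φ l (𝓝 a)) (hpos : ∀ᶠ t in l, 0 < φ t) :
    EndsAtAxisOrInfinity (spineCurve ϑ ∘ φ) l := by
  left
  rcases ha.eq_or_lt with rfl | ha
  · refine ⟨0, rfl, tendsto_zero_iff_norm_tendsto_zero.2 (hφ.congr' ?_)⟩
    filter_upwards [hpos] with t ht using (norm_spineCurve ht).symm
  · refine ⟨spineCurve ϑ a, ?_,
      ((continuousOn_spineCurve hc).continuousAt (Ioi_mem_nhds ha)).tendsto.comp hφ⟩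
    have hend : ϑ (Real.log a) = -(π / 2) ∨ ϑ (Real.log a) = π / 2 := by
      rcases eq_endpoints_or_mem_Ioo_of_mem_Icc (h (Real.log a)) with e | e | e
      · exact Or.inl e
      · exact Or.inr e
      · exact absurd ((mem_spineRadii_spineCurve h).2 ⟨ha, e⟩) haZ
    rw [spineCurve, Complex.exp_re, stripPoint_im]
    rcases hend with e | e <;> simp [e]

theorem endsAtAxisOrInfinity_of_tendsto_atTop {φ : ℝ → ℝ} {l : Filter ℝ}
    (hφ : Tendsto φ l atTop) : EndsAtAxisOrInfinity (spineCurve ϑ ∘ φ) l := by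
  right
  rw [← Metric.cobounded_eq_cocompact, ← tendsto_norm_atTop_iff_cobounded]
  refine hφ.congr' ?_
  filter_upwards [hφ.eventually_gt_atTop 0] with t ht using (norm_spineCurve ht).symm

theorem isSimpleAnalyticCurve_image (h : IsCurvatureBoundedAngle ϑ) {J : Set ℝ}
    (hJ : J ⊆ spineRadii (spineCurve ϑ)) {φ φ' : ℝ → ℝ} (hφ : AnalyticOnNhd ℝ φ (Ioo 0 1))
    (hφd : ∀ t ∈ Ioo (0 : ℝ) 1, HasDerivAt φ (φ' t) t) (hφ0 : ∀ t ∈ Ioo (0 : ℝ) 1, φ' t ≠ 0)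
    (hinj : InjOn φ (Ioo 0 1)) (himg : φ '' Ioo 0 1 = J)
    (h0 : EndsAtAxisOrInfinity (spineCurve ϑ ∘ φ) (𝓝[>] 0))
    (h1 : EndsAtAxisOrInfinity (spineCurve ϑ ∘ φ) (𝓝[<] 1)) :
    IsSimpleAnalyticCurve (spineCurve ϑ '' J) := by
  have hmem : ∀ t ∈ Ioo (0 : ℝ) 1, 0 < φ t ∧ ϑ (Real.log (φ t)) ∈ Ioo (-(π / 2)) (π / 2) :=
    fun t ht => (mem_spineRadii_spineCurve h.mem).1 (hJ (himg ▸ mem_image_of_mem φ ht))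
  refine ⟨spineCurve ϑ ∘ φ, fun t ht => ?_, fun t ht => ?_, fun s hs t ht e => ?_, ?_, h0, h1⟩
  · exact (analyticAt_spineCurve (hmem t ht).1 (h.analyticAt _ (hmem t ht).2)).comp (hφ t ht)
  · have hd := (hasDerivAt_spineCurve (hmem t ht).1 (h.hasDerivAt (hmem t ht).2)).scomp t (hφd t ht)
    rw [hd.deriv]
    refine smul_ne_zero (hφ0 t ht) (mul_ne_zero (Complex.exp_ne_zero _) (mul_ne_zero
      (inv_ne_zero (by exact_mod_cast (hmem t ht).1.ne')) fun e => ?_))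
    have := congrArg Complex.re e
    simp at this
  · exact hinj hs ht (injOn_spineCurve (hmem s hs).1 (hmem t ht).1 e)
  · rw [image_comp, himg]

theorem isSimpleAnalyticCurve_component (h : IsCurvatureBoundedAngle ϑ) {r : ℝ}
    (hr : r ∈ spineRadii (spineCurve ϑ)) :
    IsSimpleAnalyticCurve
      (spineCurve ϑ '' connectedComponentIn (spineRadii (spineCurve ϑ)) r) := by
  have hO := isOpen_spineRadii_spineCurve h.mem h.cont
  set Z := spineRadii (spineCurve ϑ) with hZ
  have hpos : ∀ x ∈ Z, 0 < x := fun x hx => hx.1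
  have hsub := connectedComponentIn_subset Z r
  have hb : BddBelow (connectedComponentIn Z r) := ⟨0, fun x hx => (hpos x (hsub hx)).le⟩
  by_cases hb' : BddAbove (connectedComponentIn Z r)
  · obtain ⟨a, b, hab, e, haZ, hbZ⟩ := exists_connectedComponentIn_eq_Ioo hO hr hb hb'
    rw [e] at hsub ⊢
    have hba : 0 < b - a := sub_pos.2 hab
    have ha : 0 ≤ a := by
      by_contra hneg
      have h1 : a < min b 0 := lt_min hab (not_le.1 hneg)
      have := hpos ((a + min b 0) / 2) (hsub ⟨by linarith, by linarith [min_le_left b 0]⟩)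
      linarith [min_le_right b 0]
    let φ : ℝ → ℝ := fun t => a + t * (b - a)
    have hφpos : ∀ t, 0 < t → 0 < φ t := fun t ht => by
      have := mul_pos ht hba
      simp only [φ]; linarith
    have hφ0 : Tendsto φ (𝓝[>] 0) (𝓝 a) := by
      have : Continuous φ := by fun_prop
      simpa [φ] using this.continuousWithinAt (s := Ioi 0) (x := 0) |>.tendsto
    have hφ1 : Tendsto φ (𝓝[<] 1) (𝓝 b) := by
      have : Continuous φ := by fun_prop
      simpa [φ] using this.continuousWithinAt (s := Iio 1) (x := 1) |>.tendsto
    refine isSimpleAnalyticCurve_image h hsub (φ := φ) (φ' := fun _ => b - a)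
      (fun t _ => analyticAt_const.add (analyticAt_id.mul analyticAt_const))
      (fun t _ => ?_) (fun t _ => hba.ne') (fun s _ t _ e => ?_) ?_
      (endsAtAxisOrInfinity_of_tendsto h.mem h.cont ha haZ hφ0 ?_)
      (endsAtAxisOrInfinity_of_tendsto h.mem h.cont (ha.trans hab.le) hbZ hφ1 ?_)
    · exact (((hasDerivAt_id t).mul_const (b - a)).const_add a).congr_deriv (one_mul _)
    · have : (s - t) * (b - a) = 0 := by simp only [φ] at e; linarith
      linarith [(mul_eq_zero.1 this).resolve_right hba.ne']
    · ext x
      constructor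
      · rintro ⟨t, ht, rfl⟩
        simp only [φ, mem_Ioo]
        constructor <;> nlinarith [ht.1, ht.2]
      · intro hx
        refine ⟨(x - a) / (b - a), ⟨div_pos (sub_pos.2 hx.1) hba, ?_⟩, ?_⟩
        · rw [div_lt_one hba]; linarith [hx.2]
        · simp only [φ]; field_simp; ring
    · filter_upwards [self_mem_nhdsWithin] with t ht using hφpos t ht
    · filter_upwards [Ioo_mem_nhdsLT (zero_lt_one (α := ℝ))] with t ht using hφpos t ht.1
  · obtain ⟨a, e, haZ⟩ := exists_connectedComponentIn_eq_Ioi hO hr hb hb'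
    rw [e] at hsub ⊢
    have ha : 0 ≤ a := by
      by_contra hneg
      exact lt_irrefl _ (hpos 0 (hsub (not_le.1 hneg)))
    let φ : ℝ → ℝ := fun t => a + (t⁻¹ - 1)⁻¹
    -- `(t⁻¹ - 1)⁻¹ = t / (1 - t)` runs from `0` to infinity
    have hψ : ∀ t ∈ Ioo (0 : ℝ) 1, 0 < t⁻¹ - 1 := fun t ht =>
      sub_pos.2 ((one_lt_inv₀ ht.1).2 ht.2)
    have hφa : ∀ t ∈ Ioo (0 : ℝ) 1, a < φ t := fun t ht => by
      have := inv_pos.2 (hψ t ht)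
      simp only [φ]; linarith
    have hφ0 : Tendsto φ (𝓝[>] 0) (𝓝 a) := by
      have h1 : Tendsto (fun t : ℝ => t⁻¹ - 1) (𝓝[>] 0) atTop :=
        tendsto_atTop_add_const_right _ _ tendsto_inv_nhdsGT_zero
      simpa [φ] using (tendsto_inv_atTop_zero.comp h1).const_add a
    have hφ1 : Tendsto φ (𝓝[<] 1) atTop := by
      have h1 : Tendsto (fun t : ℝ => t⁻¹ - 1) (𝓝[<] 1) (𝓝[>] 0) := by
        refine tendsto_nhdsWithin_iff.2 ⟨?_, ?_⟩
        · have : ContinuousAt (fun t : ℝ => t⁻¹ - 1) 1 :=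
            (continuousAt_inv₀ one_ne_zero).sub continuousAt_const
          simpa using this.tendsto.mono_left nhdsWithin_le_nhds
        · filter_upwards [Ioo_mem_nhdsLT (zero_lt_one (α := ℝ))] with t ht using hψ t ht
      exact tendsto_atTop_add_const_left _ a (tendsto_inv_nhdsGT_zero.comp h1)
    refine isSimpleAnalyticCurve_image h hsub (φ := φ)
      (φ' := fun t => -(-(t ^ 2)⁻¹) / (t⁻¹ - 1) ^ 2)
      (fun t ht => analyticAt_const.add (((analyticAt_id.inv ht.1.ne').sub
        analyticAt_const).inv (hψ t ht).ne'))
      (fun t ht => ?_) (fun t ht => ?_) (fun s _ t _ e => ?_) ?_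
      (endsAtAxisOrInfinity_of_tendsto h.mem h.cont ha haZ hφ0 ?_)
      (endsAtAxisOrInfinity_of_tendsto_atTop hφ1)
    · exact (((hasDerivAt_inv ht.1.ne').sub_const 1).inv (hψ t ht).ne').const_add a
    · have := hψ t ht
      have := ht.1
      rw [neg_neg]; positivity
    · simpa [φ] using e
    · ext x
      constructor
      · rintro ⟨t, ht, rfl⟩
        exact hφa t ht
      · intro hx
        have hxa : 0 < x - a := sub_pos.2 hx
        refine ⟨((x - a)⁻¹ + 1)⁻¹, ⟨by positivity, inv_lt_one_of_one_lt₀ (by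
          have := inv_pos.2 hxa; linarith)⟩, ?_⟩
        simp [φ]
    · filter_upwards [Ioo_mem_nhdsGT (zero_lt_one (α := ℝ))] with t ht using
        ha.trans_lt (hφa t ht)

/-! #### The length -/

theorem dist_spineCurve_le {r x y : ℝ} (hx : 0 < x) (hy : 0 < y) (hyr : y ≤ 2 * r) :
    dist (spineCurve ϑ x) (spineCurve ϑ y) ≤
      dist x y + 2 * r * dist (ϑ (Real.log x)) (ϑ (Real.log y)) := by
  have e : ∀ s : ℝ, 0 < s → spineCurve ϑ s = s * Complex.exp (Complex.I * ϑ (Real.log s)) :=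
    fun s hs => by
      rw [spineCurve, stripPoint_eq, Complex.exp_add, ← Complex.ofReal_exp, Real.exp_log hs,
        mul_comm Complex.I]
  have hn : ∀ θ : ℝ, ‖Complex.exp (Complex.I * θ)‖ = 1 := fun θ => by
    rw [mul_comm, Complex.norm_exp_ofReal_mul_I]
  rw [dist_eq_norm, e x hx, e y hy]
  have split : (x : ℂ) * Complex.exp (Complex.I * ϑ (Real.log x)) -
      y * Complex.exp (Complex.I * ϑ (Real.log y)) =
      ((x - y : ℝ) : ℂ) * Complex.exp (Complex.I * ϑ (Real.log x)) +
      y * (Complex.exp (Complex.I * ϑ (Real.log x)) -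
        Complex.exp (Complex.I * ϑ (Real.log y))) := by
    push_cast; ring
  have hexp : ∀ s t : ℝ, ‖Complex.exp (Complex.I * s) - Complex.exp (Complex.I * t)‖ ≤ |s - t| :=
    fun s t => by
      have h1 : Complex.exp (Complex.I * s) - Complex.exp (Complex.I * t) =
          Complex.exp (Complex.I * t) * (Complex.exp (Complex.I * (s - t : ℝ)) - 1) := by
        rw [mul_sub, ← Complex.exp_add, mul_one]; push_cast; ring_nf
      rw [h1, norm_mul, hn, one_mul]
      exact Real.norm_exp_I_mul_ofReal_sub_one_le
  rw [split]
  refine (norm_add_le _ _).trans (add_le_add ?_ ?_)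
  · rw [norm_mul, hn, mul_one, Complex.norm_real]; exact le_rfl
  · rw [norm_mul, Complex.norm_real, Real.norm_of_nonneg hy.le, Real.dist_eq]
    exact mul_le_mul hyr (hexp _ _) (norm_nonneg _) (by linarith)

theorem eVariationOn_spineCurve_le (h : IsCurvatureBoundedAngle ϑ) {r : ℝ} (hr : 0 < r)
    {J : Set ℝ} (hJ : J.OrdConnected) (hsub : J ⊆ spineRadii (spineCurve ϑ) ∩ Icc r (2 * r)) :
    eVariationOn (spineCurve ϑ) J ≤ volume J +
      ENNReal.ofReal (2 * r) * ∫⁻ x in Real.exp ⁻¹' J, ‖deriv ϑ x‖ₑ := by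
  have hpos : ∀ x ∈ J, 0 < x := fun x hx => (hsub hx).1.1
  have hid : eVariationOn id J ≤ volume J := by
    have := eVariationOn_le_setLIntegral_enorm_deriv (φ := id) hJ
      (fun x _ => by rw [deriv_id]; exact hasDerivAt_id x)
      (by simp only [deriv_id']; exact continuousOn_const)
    simpa using this
  have hexpJ : (Real.exp ⁻¹' J).OrdConnected := hJ.preimage_mono Real.exp_monotone
  have hmem : ∀ x ∈ Real.exp ⁻¹' J, ϑ x ∈ Ioo (-(π / 2)) (π / 2) := fun x hx => by
    have := ((mem_spineRadii_spineCurve h.mem).1 (hsub hx).1).2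
    rwa [Real.log_exp] at this
  have hvar : eVariationOn (ϑ ∘ Real.log) J ≤ ∫⁻ x in Real.exp ⁻¹' J, ‖deriv ϑ x‖ₑ :=
    (eVariationOn.comp_le_of_monotoneOn ϑ Real.log
      (fun x hx y _ hxy => Real.log_le_log (hpos x hx) hxy)
      (fun x hx => by rw [mem_preimage, Real.exp_log (hpos x hx)]; exact hx)).trans
    (eVariationOn_le_setLIntegral_enorm_deriv hexpJ (fun x hx => h.hasDerivAt (hmem x hx))
      fun x hx => (h.continuousAt_deriv (hmem x hx)).continuousWithinAt)
  refine le_trans ?_ (add_le_add hid (mul_le_mul_right hvar _))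
  refine iSup_le fun p => ?_
  obtain ⟨n, u, hu, huJ⟩ := p
  calc ∑ i ∈ Finset.range n, edist (spineCurve ϑ (u (i + 1))) (spineCurve ϑ (u i))
      ≤ ∑ i ∈ Finset.range n, (edist (id (u (i + 1))) (id (u i)) + ENNReal.ofReal (2 * r) *
          edist ((ϑ ∘ Real.log) (u (i + 1))) ((ϑ ∘ Real.log) (u i))) := by
        refine Finset.sum_le_sum fun i _ => ?_
        rw [edist_dist, edist_dist, edist_dist, ← ENNReal.ofReal_mul (by linarith),
          ← ENNReal.ofReal_add dist_nonneg (by positivity)]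
        exact ENNReal.ofReal_le_ofReal (dist_spineCurve_le (hpos _ (huJ _)) (hpos _ (huJ _))
          (hsub (huJ i)).2.2)
    _ ≤ _ := by
        rw [Finset.sum_add_distrib, ← Finset.mul_sum]
        exact add_le_add (eVariationOn.sum_le hu huJ)
          (mul_le_mul_right (eVariationOn.sum_le hu huJ) _)

theorem totalLength_spineCurve_le (h : IsCurvatureBoundedAngle ϑ)
    (hcross : ∀ z₁ z₂ b, ϑ z₁ = 0 → ϑ z₂ = 0 → b ∈ Ioo z₁ z₂ → z₂ - z₁ ≤ 1 / 10 →
      |ϑ b| < π / 6) {r : ℝ} (hr : 0 < r) :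
    totalLength (spineCurve ϑ) (spineRadii (spineCurve ϑ) ∩ Icc r (2 * r)) ≤
      ENNReal.ofReal (300 * r) := by
  set S := spineRadii (spineCurve ϑ) ∩ Icc r (2 * r) with hS
  have hlog : Real.log (2 * r) = Real.log 2 + Real.log r :=
    Real.log_mul two_ne_zero hr.ne'
  have hlog2 := Real.log_two_lt_d9
  have hlog2' := Real.log_two_gt_d9
  have htot := h.setLIntegral_enorm_deriv_le hcross (A := Real.log r) (B := Real.log (2 * r))
    (by rw [hlog]; linarith) (by rw [hlog]; linarith)
  rw [totalLength, ENNReal.tsum_eq_iSup_sum]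
  refine iSup_le fun s => ?_
  have hord : ∀ J : {J : Set ℝ | ∃ x ∈ S, J = connectedComponentIn S x},
      (J : Set ℝ).OrdConnected ∧ (J : Set ℝ) ⊆ S := fun J => by
    obtain ⟨x, -, e⟩ := J.2
    rw [e]
    exact ⟨isPreconnected_connectedComponentIn.ordConnected, connectedComponentIn_subset S x⟩
  have hdisj : (s : Set {J : Set ℝ | ∃ x ∈ S, J = connectedComponentIn S x}).PairwiseDisjoint
      fun J => (J : Set ℝ) := fun J₁ _ J₂ _ hne =>
    disjoint_of_components J₁.2 J₂.2 fun e => hne (Subtype.ext e)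
  have hsum1 : ∑ J ∈ s, volume (J : Set ℝ) ≤ ENNReal.ofReal r := by
    rw [← measure_biUnion_finset hdisj fun J _ => (hord J).1.measurableSet]
    refine (measure_mono (iUnion₂_subset fun J _ => (hord J).2.trans inter_subset_right)).trans ?_
    rw [Real.volume_Icc]
    exact ENNReal.ofReal_le_ofReal (by linarith)
  have hsum2 : ∑ J ∈ s, ∫⁻ x in Real.exp ⁻¹' (J : Set ℝ), ‖deriv ϑ x‖ₑ ≤
      ENNReal.ofReal (10 * (Real.log (2 * r) - Real.log r) + 12 * π) := by
    rw [← lintegral_biUnion_finset (t := fun J : {J : Set ℝ | ∃ x ∈ S,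
      J = connectedComponentIn S x} => Real.exp ⁻¹' (J : Set ℝ))
      (fun J₁ h1 J₂ h2 hne => (hdisj h1 h2 hne).preimage _)
      fun J _ => (hord J).1.measurableSet.preimage Real.measurable_exp]
    refine (lintegral_mono_set (iUnion₂_subset fun J _ x hx => ?_)).trans htot
    have hx' := (hord J).2 hx
    have h1 := ((mem_spineRadii_spineCurve h.mem).1 hx'.1).2
    rw [Real.log_exp] at h1
    refine ⟨⟨?_, ?_⟩, h1⟩
    · rw [Real.log_le_iff_le_exp hr]; exact hx'.2.1
    · rw [Real.le_log_iff_exp_le (by linarith)]; exact hx'.2.2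
  calc ∑ J ∈ s, eVariationOn (spineCurve ϑ) (J : Set ℝ)
      ≤ ∑ J ∈ s, (volume (J : Set ℝ) + ENNReal.ofReal (2 * r) *
          ∫⁻ x in Real.exp ⁻¹' (J : Set ℝ), ‖deriv ϑ x‖ₑ) :=
        Finset.sum_le_sum fun J _ => eVariationOn_spineCurve_le h hr (hord J).1 (hord J).2
    _ ≤ ENNReal.ofReal r + ENNReal.ofReal (2 * r) *
          ENNReal.ofReal (10 * (Real.log (2 * r) - Real.log r) + 12 * π) := by
        rw [Finset.sum_add_distrib, ← Finset.mul_sum]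
        exact add_le_add hsum1 (mul_le_mul_right hsum2 _)
    _ ≤ ENNReal.ofReal (300 * r) := by
        have hpi := Real.pi_pos
        rw [← ENNReal.ofReal_mul (by linarith), ← ENNReal.ofReal_add hr.le (by
          rw [hlog]; exact mul_nonneg (by linarith) (by linarith))]
        refine ENNReal.ofReal_le_ofReal ?_
        rw [hlog]
        nlinarith [Real.pi_lt_four]

/-! #### The derivatives of the angle -/

theorem contDiffOn_arg_spineCurve (h : IsCurvatureBoundedAngle ϑ) :
    ContDiffOn ℝ 2 (fun r => (spineCurve ϑ r).arg) (spineRadii (spineCurve ϑ)) := by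
  intro r hr
  obtain ⟨hr0, hr⟩ := (mem_spineRadii_spineCurve h.mem).1 hr
  simp only [arg_spineCurve h.mem]
  exact ((h.analyticAt _ hr).fun_comp (analyticAt_log hr0)).contDiffAt.contDiffWithinAt

/-- In the variable `R = log r` the operator `r d/dr` is `d/dR`, so that this is the differential
inequality of `IsCurvatureBoundedAngle`, even with `3` in place of `9`. -/
theorem abs_mul_deriv_mul_deriv_arg_le (h : IsCurvatureBoundedAngle ϑ) {r : ℝ}
    (hr : r ∈ spineRadii (spineCurve ϑ)) :
    |r * deriv (fun s => s * deriv (fun u => (spineCurve ϑ u).arg) s) r| ≤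
      9 * ((r * deriv (fun u => (spineCurve ϑ u).arg) r) ^ 2 + 1) /
        Real.cos (spineCurve ϑ r).arg := by
  have hO := isOpen_spineRadii_spineCurve h.mem h.cont
  have hd : ∀ s ∈ spineRadii (spineCurve ϑ),
      s * deriv (fun u => (spineCurve ϑ u).arg) s = deriv ϑ (Real.log s) := fun s hs => by
    obtain ⟨hs0, hs⟩ := (mem_spineRadii_spineCurve h.mem).1 hs
    simp only [arg_spineCurve h.mem]
    have := (h.hasDerivAt hs).comp s (Real.hasDerivAt_log hs0.ne')
    have e : deriv (fun u => ϑ (Real.log u)) s = deriv ϑ (Real.log s) * s⁻¹ := this.deriv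
    rw [e]; field_simp
  obtain ⟨hr0, hrI⟩ := (mem_spineRadii_spineCurve h.mem).1 hr
  have hd2 : r * deriv (fun s => s * deriv (fun u => (spineCurve ϑ u).arg) s) r =
      deriv (deriv ϑ) (Real.log r) := by
    have hev : (fun s => s * deriv (fun u => (spineCurve ϑ u).arg) s) =ᶠ[𝓝 r]
        fun s => deriv ϑ (Real.log s) := by
      filter_upwards [hO.mem_nhds hr] with s hs using hd s hs
    have := (h.hasDerivAt_deriv hrI).comp r (Real.hasDerivAt_log hr0.ne')
    have e : deriv (fun s => deriv ϑ (Real.log s)) r =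
      deriv (deriv ϑ) (Real.log r) * r⁻¹ := this.deriv
    rw [hev.deriv_eq, e]; field_simp
  rw [hd2, hd r hr, arg_spineCurve h.mem]
  have hcos := Real.cos_pos_of_mem_Ioo hrI
  have hcurv := h.curvature_le _ hrI
  rw [le_div_iff₀ hcos]
  set t := deriv ϑ (Real.log r)
  set t' := deriv (deriv ϑ) (Real.log r)
  set c := Real.cos (ϑ (Real.log r))
  set s := Real.sin (ϑ (Real.log r))
  have hs : |s| ≤ 1 := Real.abs_sin_le_one _
  have h1 : |c * t'| ≤ 2 * (1 + t ^ 2) + |s| * (1 + t ^ 2) := by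
    have h2 := abs_sub (c * t' + s * (1 + t ^ 2)) (s * (1 + t ^ 2))
    rw [add_sub_cancel_right, abs_mul s, abs_of_nonneg (show 0 ≤ 1 + t ^ 2 by positivity)] at h2
    linarith
  rw [abs_mul, abs_of_pos hcos] at h1
  nlinarith [sq_nonneg t, abs_nonneg s]

end SpineCurve

namespace IsSpineAngle

variable {f : ℂ → ℂ} {ϑ : ℝ → ℝ}

theorem isSpineFunction (h : IsSpineAngle f ϑ) (hc : Continuous ϑ) :
    IsSpineFunction f (spineCurve ϑ) where
  cont := continuousOn_spineCurve hc
  norm_eq _ hr := norm_spineCurve hr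
  arg_mem r _ := by rw [arg_spineCurve h.mem]; exact h.mem _
  sign_im ξ hξ := by
    have := h.sign _ (log_mem_logStrip hξ)
    rwa [logLift, Complex.exp_log (ne_zero_of_mem_rightHalfPlane hξ), Complex.log_im,
      Complex.log_re, ← arg_spineCurve h.mem] at this

theorem eqOn_spineCurve (h : IsSpineAngle f ϑ) {ζ : ℝ → ℂ} (hζ : IsSpineFunction f ζ) :
    EqOn ζ (spineCurve ϑ) (Ioi 0) := by
  have h' : IsSpineAngle f fun R => (ζ (Real.exp R)).arg := by
    refine ⟨fun R => hζ.arg_mem _ (Real.exp_pos R), fun w hw => ?_⟩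
    have := hζ.sign_im _ (exp_mem_rightHalfPlane hw)
    rwa [Complex.norm_exp, arg_exp_of_mem_Icc (Ioo_subset_Icc_self hw)] at this
  have e := h.unique h'
  intro r hr
  refine Complex.ext_norm_arg ?_ ?_
  · rw [hζ.norm_eq r hr, norm_spineCurve hr]
  · rw [arg_spineCurve h.mem, e]
    simp only [Real.exp_log hr]

theorem spine_eq (h : IsSpineAngle f ϑ)
    (hpos : ∀ ξ ∈ rightHalfPlane, (f ξ).im = 0 → 0 < (f ξ).re) :
    spine f = spineCurve ϑ '' spineRadii (spineCurve ϑ) := by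
  ext ξ
  constructor
  · rintro ⟨hξ, x, -, hx⟩
    have hξ0 := ne_zero_of_mem_rightHalfPlane hξ
    have hw := log_mem_logStrip hξ
    have hnorm : 0 < ‖ξ‖ := norm_pos_iff.2 hξ0
    have he : ξ.arg = ϑ (Real.log ‖ξ‖) := by
      have := (h.im_eq_zero_iff (R := (Complex.log ξ).re) hw).1 (by
        rw [stripPoint_eta, logLift, Complex.exp_log hξ0, hx, Complex.ofReal_im])
      rwa [Complex.log_im, Complex.log_re] at this
    refine ⟨‖ξ‖, (mem_spineRadii_spineCurve h.mem).2 ⟨hnorm, ?_⟩, ?_⟩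
    · rw [← he, ← Complex.log_im]; exact hw
    · rw [spineCurve, ← he, ← Complex.log_im, ← Complex.log_re, stripPoint_eta,
        Complex.exp_log hξ0]
  · rintro ⟨r, hr, rfl⟩
    obtain ⟨-, hrI⟩ := (mem_spineRadii_spineCurve h.mem).1 hr
    have hw := stripPoint_mem (R := Real.log r).2 hrI
    have hmem := exp_mem_rightHalfPlane hw
    have h0 : (f (spineCurve ϑ r)).im = 0 := (h.im_eq_zero_iff hrI).2 rfl
    exact ⟨hmem, (f (spineCurve ϑ r)).re, hpos _ hmem h0, Complex.ext rfl h0⟩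

end IsSpineAngle

/-- The angle of the spine exists and has all the properties that the spine depends on. In the
degenerate case `f ξ = κ + i k ξ`, where `k ≠ 0`, the imaginary part of `f` has a constant sign and
the angle is one of `± π / 2`. -/
theorem IsRogers.exists_regular_angle {f : ℂ → ℂ} (hf : IsRogers f)
    (hconst : ¬IsConstOnHalfPlane f) :
    ∃ ϑ : ℝ → ℝ, IsSpineAngle f ϑ ∧ IsCurvatureBoundedAngle ϑ ∧
      (∀ z₁ z₂ b, ϑ z₁ = 0 → ϑ z₂ = 0 → b ∈ Ioo z₁ z₂ → z₂ - z₁ ≤ 1 / 10 → |ϑ b| < π / 6) ∧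
      ∀ ξ ∈ rightHalfPlane, (f ξ).im = 0 → 0 < (f ξ).re := by
  have hpi := Real.pi_pos
  by_cases hB : ∀ w ∈ logStrip, 0 < angularSlope f w
  · obtain ⟨ϑ, h⟩ := hf.exists_isSpineAngle hB
    exact ⟨ϑ, h, h.isCurvatureBoundedAngle hf hB,
      fun _ _ _ h1 h2 hb hz => h.abs_lt_of_zeros hf hB h1 h2 hb hz,
      fun _ hξ him => hf.re_pos_of_im_eq_zero hB hξ him⟩
  · push Not at hB
    obtain ⟨w, hw, hle⟩ := hB
    obtain ⟨κ, k, hk⟩ := hf.eq_affine_of_angularSlope_eq_zero hw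
      (le_antisymm hle (hf.exists_gradient_angularSlope hw).1)
    have hk0 : k ≠ 0 := by
      rintro rfl
      exact hconst ⟨κ, fun ξ hξ => by rw [hk ξ hξ]; simp⟩
    have him : ∀ ξ ∈ rightHalfPlane, (f ξ).im = k * ξ.re := fun ξ hξ => by
      rw [hk ξ hξ]; simp
    have hsign : ∀ ξ ∈ rightHalfPlane, SignType.sign (f ξ).im = SignType.sign k := fun ξ hξ => by
      have hx : 0 < ξ.re := hξ
      rw [him ξ hξ, sign_mul, sign_pos hx, mul_one]
    -- the conditions on the points with `|ϑ| < π / 2` are empty for these two angles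
    have hvac : ∀ θ : ℝ, |θ| = π / 2 → IsCurvatureBoundedAngle fun _ => θ := fun θ hθ => by
      have hno : θ ∉ Ioo (-(π / 2)) (π / 2) := fun hmem => (abs_lt.2 hmem).ne hθ
      exact ⟨fun _ => abs_le.1 hθ.le, continuous_const, fun _ hR => absurd hR hno,
        fun _ hR => absurd hR hno⟩
    have hpos : ∀ ξ ∈ rightHalfPlane, (f ξ).im = 0 → 0 < (f ξ).re := fun ξ hξ h0 => by
      have hx : 0 < ξ.re := hξ
      rw [him ξ hξ] at h0
      exact absurd h0 (mul_ne_zero hk0 hx.ne')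
    rcases lt_or_gt_of_ne hk0 with hneg | hkpos
    · refine ⟨fun _ => π / 2, ⟨fun _ => ⟨by linarith, le_rfl⟩, fun v hv => ?_⟩,
        hvac _ (abs_of_pos (by linarith)), fun z₁ _ _ h1 => ?_, hpos⟩
      · rw [logLift, hsign _ (exp_mem_rightHalfPlane hv), sign_neg hneg,
          sign_neg (by linarith [hv.2])]
      · linarith
    · refine ⟨fun _ => -(π / 2), ⟨fun _ => ⟨le_rfl, by linarith⟩, fun v hv => ?_⟩,
        hvac _ (by rw [abs_neg, abs_of_pos (by linarith)]), fun z₁ _ _ h1 => ?_, hpos⟩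
      · rw [logLift, hsign _ (exp_mem_rightHalfPlane hv), sign_pos hkpos,
          sign_pos (by linarith [hv.1])]
      · linarith

theorem theorem4p2 (f : ℂ → ℂ) (hf : IsRogers f) (hconst : ¬ IsConstOnHalfPlane f) :
    ∃ ζ : ℝ → ℂ,
      -- continuity, parts (a) and (b), and uniqueness on (0, ∞)
      IsSpineFunction f ζ ∧
      (∀ ζ' : ℝ → ℂ, IsSpineFunction f ζ' → EqOn ζ' ζ (Ioi 0)) ∧
      -- part (c)
      (∃ 𝒞 : Set (Set ℂ), 𝒞.PairwiseDisjoint id ∧ (∀ C ∈ 𝒞, IsSimpleAnalyticCurve C) ∧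
        spine f = ⋃₀ 𝒞) ∧
      spine f = ζ '' spineRadii ζ ∧
      AnalyticOnNhd ℝ ζ (spineRadii ζ) ∧
      -- part (d): length of the spine in annuli
      (∀ r : ℝ, 0 < r →
        spine f ∩ {ξ | r ≤ ‖ξ‖ ∧ ‖ξ‖ ≤ 2 * r} = ζ '' (spineRadii ζ ∩ Icc r (2 * r)) ∧
        totalLength ζ (spineRadii ζ ∩ Icc r (2 * r)) ≤ ENNReal.ofReal (300 * r)) ∧
      -- part (d): the bound for the curvature
      ContDiffOn ℝ 2 (fun r => (ζ r).arg) (spineRadii ζ) ∧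
      (∀ r ∈ spineRadii ζ,
        |r * deriv (fun s => s * deriv (fun u => (ζ u).arg) s) r| ≤
          9 * ((r * deriv (fun u => (ζ u).arg) r) ^ 2 + 1) / Real.cos (ζ r).arg) := by
  obtain ⟨ϑ, hϑ, h, hcross, hpos⟩ := hf.exists_regular_angle hconst
  have hspine := hϑ.spine_eq hpos
  refine ⟨spineCurve ϑ, hϑ.isSpineFunction h.cont, fun ζ' hζ' => hϑ.eqOn_spineCurve hζ', ?_,
    hspine, fun r hr => ?_, fun r hr => ⟨?_, totalLength_spineCurve_le h hcross hr⟩,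
    contDiffOn_arg_spineCurve h, fun r hr => abs_mul_deriv_mul_deriv_arg_le h hr⟩
  · refine ⟨{C | ∃ r ∈ spineRadii (spineCurve ϑ),
      C = spineCurve ϑ '' connectedComponentIn (spineRadii (spineCurve ϑ)) r}, ?_, ?_, ?_⟩
    · rintro _ ⟨x, hx, rfl⟩ _ ⟨y, hy, rfl⟩ hne
      have hd := disjoint_of_components ⟨x, hx, rfl⟩ ⟨y, hy, rfl⟩ fun e => hne (by rw [e])
      have hsub : ∀ x, connectedComponentIn (spineRadii (spineCurve ϑ)) x ⊆ Ioi 0 := fun x y hy =>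
        (connectedComponentIn_subset _ x hy).1
      refine Set.disjoint_left.2 ?_
      rintro _ ⟨u, hu, rfl⟩ ⟨v, hv, e⟩
      exact hd.ne_of_mem hu hv (injOn_spineCurve (hsub y hv) (hsub x hu) e).symm
    · rintro _ ⟨x, hx, rfl⟩
      exact isSimpleAnalyticCurve_component h hx
    · rw [hspine]
      refine Subset.antisymm ?_ (sUnion_subset ?_)
      · rintro _ ⟨r, hr, rfl⟩
        exact ⟨_, ⟨r, hr, rfl⟩, mem_image_of_mem _ (mem_connectedComponentIn hr)⟩
      · rintro _ ⟨r, hr, rfl⟩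
        exact image_mono (connectedComponentIn_subset _ r)
  · obtain ⟨hr0, hrI⟩ := (mem_spineRadii_spineCurve h.mem).1 hr
    exact analyticAt_spineCurve hr0 (h.analyticAt _ hrI)
  · rw [hspine]
    ext ξ
    constructor
    · rintro ⟨⟨s, hs, rfl⟩, hξ⟩
      rw [mem_ofPred_eq, norm_spineCurve hs.1] at hξ
      exact ⟨s, ⟨hs, hξ⟩, rfl⟩
    · rintro ⟨s, ⟨hs, hsr⟩, rfl⟩
      refine ⟨⟨s, hs, rfl⟩, ?_⟩
      rw [mem_ofPred_eq, norm_spineCurve hs.1]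
      exact hsr
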